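/- Let $L>0$, $\omega:=(0,L)\times(0,1)$ with points $(x_1,s)$, and let $\gamma:[0,1]\to\mathbb{R}^3$, $\gamma(s)=(0,\gamma_2(s),\gamma_3(s))$, be a planar curve of class $C^6$ parametrized by arclength, with tangent vector $\tau:=\dot\gamma$ and normal vector $n:=(0,-\tau_3,\tau_2)$. For a field $v:\omega\to\mathbb{R}^3$ set $$e(v):=\begin{pmatrix}\partial_1 v_1&\tfrac12(\partial_s v_1+\partial_1 v\cdot\tau)\\ \tfrac12(\partial_s v_1+\partial_1 v\cdot\tau)&\partial_s v\cdot\tau\end{pmatrix}.$$ For $\mu\in\mathbb{R}$, $\mu\neq0$, let $\mathcal{C}_\mu$ be the set of all pairs $(g,b)\in L^2(\omega)\times L^2(\omega)$ for which there exists $v\in L^2(\omega;\mathbb{R}^3)$ with $\partial_s v\in L^2(\omega;\mathbb{R}^3)$ such that $$\partial_s v\cdot\tau=0,\qquad \partial_s(\partial_s v\cdot n)=b,\qquad \partial_1^2 v\cdot\tau+\mu\,\partial_s g=0$$ on $\omega$, the last two equalities being understood in the sense of distributions. Let $\mu\neq0$ and $(g,b)\in\mathcal{C}_\mu$. Then there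 exists a sequence $(\phi^{j})_{j\in\mathbb{N}}\subset C^5(\overline{\omega};\mathbb{R}^3)$ such that, for every $j$, $$e(\phi^{j})=\begin{pmatrix}\partial_1\phi^{j}_1&0\\0&0\end{pmatrix}\quad\text{on }\omega,$$ and, as $j\to\infty$, $$e(\phi^{j})\to\begin{pmatrix}\mu g&0\\0&0\end{pmatrix}\ \text{ strongly in }L^2(\omega;\mathbb{M}^{2\times2}_{\mathrm{sym}}),\qquad \partial_s(\partial_s\phi^{j}\cdot n)\to b\ \text{ strongly in }L^2(\omega).$$ -/

import Mathlib

open Set Filter Topology MeasureTheory TopologicalSpace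
open scoped ENNReal Distributions RealInnerProductSpace

-- Matrices carry the Euclidean (Frobenius) norm `|M| = (∑ mᵢⱼ²)^{1/2}`.
attribute [local instance] Matrix.frobeniusNormedAddCommGroup

namespace ThinWalledBeam

/-- Three-dimensional Euclidean space. The basis vectors `e₁, e₂, e₃` of the text have the
indices `0, 1, 2`. -/
abbrev E3 : Type := EuclideanSpace ℝ (Fin 3)

/-- `γ : [0,1] → ℝ³`, `γ(s) = (0, γ₂(s), γ₃(s))`, is a planar curve of class `C⁶` parametrized by
arclength. Only the values of `γ` on `[0,1]` matter. -/
structure IsPlanarArclengthCurve (γ : ℝ → E3) : Prop where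
  contDiffOn : ContDiffOn ℝ 6 γ (Icc 0 1)
  fst_eq_zero : ∀ s ∈ Icc (0 : ℝ) 1, γ s 0 = 0
  norm_deriv : ∀ s ∈ Icc (0 : ℝ) 1, ‖derivWithin γ (Icc 0 1) s‖ = 1

/-- The tangent vector `τ(s) = γ̇(s)`. -/
noncomputable def tangentVec (γ : ℝ → E3) (s : ℝ) : E3 := derivWithin γ (Icc 0 1) s

/-- The normal vector `n(s) = (0, -τ₃(s), τ₂(s))`. -/
noncomputable def normalVec (γ : ℝ → E3) (s : ℝ) : E3 :=
  !₂[0, -(tangentVec γ s 2), tangentVec γ s 1]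

/-- The open rectangle `ω = (0,L) × (0,1)`, with points `(x₁, s)`. -/
def omega (L : ℝ) : Opens (ℝ × ℝ) := ⟨Ioo 0 L ×ˢ Ioo 0 1, isOpen_Ioo.prod isOpen_Ioo⟩

/-- Lebesgue measure on `ω`. -/
noncomputable def volOmega (L : ℝ) : Measure (ℝ × ℝ) :=
  volume.restrict (omega L : Set (ℝ × ℝ))

section Partial

variable {F : Type*} [NormedAddCommGroup F] [NormedSpace ℝ F]

/-- The classical partial derivative `∂₁ f`, in the variable `x₁`. -/
noncomputable def pd1 (f : ℝ × ℝ → F) (p : ℝ × ℝ) : F := deriv (fun x => f (x, p.2)) p.1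

/-- The classical partial derivative `∂ₛ f`, in the variable `s`. -/
noncomputable def pdS (f : ℝ × ℝ → F) (p : ℝ × ℝ) : F := deriv (fun s => f (p.1, s)) p.2

/-- `∂ₛ f = g` in the sense of distributions on `ω`. -/
def IsWeakPdS (L : ℝ) (f g : ℝ × ℝ → F) : Prop :=
  ∀ η : 𝓓(omega L, ℝ),
    (∫ p, pdS (η : ℝ × ℝ → ℝ) p • f p ∂volOmega L) = -(∫ p, η p • g p ∂volOmega L)

end Partial

/-- The class `C_μ` (for `μ ≠ 0`): the pairs `(g, b) ∈ L²(ω) × L²(ω)` for which there is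
`v ∈ L²(ω; ℝ³)` with weak derivative `∂ₛ v = w ∈ L²(ω; ℝ³)` such that `∂ₛ v · τ = 0` a.e. in `ω`,
and `∂ₛ(∂ₛ v · n) = b`, `∂₁² v · τ + μ ∂ₛ g = 0` in the sense of distributions.
As `τ` depends on `s` only, `∂₁² v · τ` is the distribution `∂₁² (v · τ)`. -/
def classC (L μ : ℝ) (γ : ℝ → E3) : Set ((ℝ × ℝ → ℝ) × (ℝ × ℝ → ℝ)) :=
  {gb | MemLp gb.1 2 (volOmega L) ∧ MemLp gb.2 2 (volOmega L) ∧
    ∃ v w : ℝ × ℝ → E3, MemLp v 2 (volOmega L) ∧ MemLp w 2 (volOmega L) ∧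
      IsWeakPdS L v w ∧
      (∀ᵐ p ∂volOmega L, ⟪w p, tangentVec γ p.2⟫ = 0) ∧
      IsWeakPdS L (fun p => ⟪w p, normalVec γ p.2⟫) gb.2 ∧
      ∀ η : 𝓓(omega L, ℝ),
        (∫ p, ⟪v p, tangentVec γ p.2⟫ * pd1 (pd1 (η : ℝ × ℝ → ℝ)) p ∂volOmega L)
          - μ * (∫ p, gb.1 p * pdS (η : ℝ × ℝ → ℝ) p ∂volOmega L) = 0}

/-- The symmetric gradient `e(v)` of a (continuously differentiable) field `v`. -/
noncomputable def symGrad (γ : ℝ → E3) (v : ℝ × ℝ → E3) (p : ℝ × ℝ) : Matrix (Fin 2) (Fin 2) ℝ :=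
  !![pd1 (fun q => v q 0) p,
      (1 / 2) * (pdS (fun q => v q 0) p + ⟪pd1 v p, tangentVec γ p.2⟫);
    (1 / 2) * (pdS (fun q => v q 0) p + ⟪pd1 v p, tangentVec γ p.2⟫),
      ⟪pdS v p, tangentVec γ p.2⟫]

/-- The function `∂ₛ(∂ₛ v · n)` of a (twice continuously differentiable) field `v`. -/
noncomputable def bending (γ : ℝ → E3) (v : ℝ × ℝ → E3) : ℝ × ℝ → ℝ :=
  pdS (fun q => ⟪pdS v q, normalVec γ q.2⟫)

/-- Strong convergence `f j → f∞` in `L²(ω; F)`. -/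
def TendstoL2 {F : Type*} [NormedAddCommGroup F] (L : ℝ) (f : ℕ → ℝ × ℝ → F)
    (flim : ℝ × ℝ → F) : Prop :=
  Tendsto (fun j => eLpNorm (fun p => f j p - flim p) 2 (volOmega L)) atTop (𝓝 0)

end ThinWalledBeam

open ThinWalledBeam

/-! Write θ = ∂ₛv · n for the rotation. The equations defining the class form a chain of ODEs in s:
θ' = b, (v₂, v₃)' = θ n, and μ ∂ₛg = -∂₁²(v · τ). Each axial strain is thus determined by the
bending, up to integration constants that depend on x₁ only. The chain is only weak, and x₁ enters
through two derivatives. Testing it with ψ(x₁) moves both derivatives onto ψ and leaves genuine ODEs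
in s for the averages (`IsWeakSolution.strain_ae_eq`). The ψ-average of μg is then an explicit
combination of 1, ∫τ₂, ∫τ₃ and the warping of a unit rotation, minus the warping of the primitive of
the ψ''-average of b.

Conversely, a field (-a'R, a q₂, a q₃) with q' = θ n and R' = τ · q has no strain but the axial one
-a''R, and its bending is aθ' (`realizable_mode`). For smooth data these modes have exactly the
structure of the representation formula. Choose ψ = η(lam x + c - ·), a mollifier at a slightly
contracted point, so that its support stays inside (0, L) for every x in [0, L], boundary included.
The coefficients are then smooth in x, and every term of the formula coming from an integration
constant is realized exactly (`IsWeakSolution.realizable`). The contraction produces a factor lam²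
in second derivatives, which the amplitudes compensate by lam⁻².

The remaining obstacle is the regularity in s: b is merely L², while the field must be C⁵. So b is
replaced by a finite sum C of products α(x₁)β(s) with smooth β. The resulting error in the strain is
at most 2 sup|η''| ‖b - C‖₁ (`IsWeakSolution.average_sub_le`). It becomes small because C is chosen
after the mollifier. The L² convergence of the averages themselves follows from a Schur bound and
density of continuous functions. -/

namespace ThinWalledBeam

/-! ### Test functions, primitives and weak derivatives on (0, 1) -/

/-- Smooth functions with compact support in `U`. -/
structure IsTestOn (U : Set ℝ) (ψ : ℝ → ℝ) : Prop where
  contDiff : ContDiff ℝ (⊤ : ℕ∞) ψ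
  hasCompactSupport : HasCompactSupport ψ
  tsupport_subset : tsupport ψ ⊆ U

theorem IsTestOn.eq_zero {U : Set ℝ} {ψ : ℝ → ℝ} (h : IsTestOn U ψ) {x : ℝ} (hx : x ∉ U) :
    ψ x = 0 :=
  image_eq_zero_of_notMem_tsupport fun h' => hx (h.tsupport_subset h')

theorem IsTestOn.deriv {U : Set ℝ} {ψ : ℝ → ℝ} (h : IsTestOn U ψ) : IsTestOn U (deriv ψ) where
  contDiff := (contDiff_infty_iff_deriv.1 h.contDiff).2
  hasCompactSupport := h.hasCompactSupport.deriv
  tsupport_subset := (tsupport_deriv_subset).trans h.tsupport_subset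

theorem IsTestOn.hasDerivAt {U : Set ℝ} {ψ : ℝ → ℝ} (h : IsTestOn U ψ) (x : ℝ) :
    HasDerivAt ψ (_root_.deriv ψ x) x :=
  (h.contDiff.differentiable (by simp)).differentiableAt.hasDerivAt

/-- Lebesgue measure on `(a, b)`. -/
noncomputable abbrev volIoo (a b : ℝ) : Measure ℝ := volume.restrict (Ioo a b)

theorem volOmega_eq_prod (L : ℝ) : volOmega L = (volIoo 0 L).prod (volIoo 0 1) := by
  rw [volOmega, volIoo, volIoo, Measure.prod_restrict]; rfl

/-- The primitive vanishing at `0`. -/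
noncomputable def prim (f : ℝ → ℝ) (s : ℝ) : ℝ := ∫ t in (0 : ℝ)..s, f t

theorem integral_volIoo (f : ℝ → ℝ) : ∫ t, f t ∂volIoo 0 1 = ∫ t in (0 : ℝ)..1, f t := by
  rw [intervalIntegral.integral_of_le zero_le_one, integral_Ioc_eq_integral_Ioo]

theorem intervalIntegrable_of_volIoo {f : ℝ → ℝ} (hf : Integrable f (volIoo 0 1)) :
    IntervalIntegrable f volume 0 1 := by
  rw [intervalIntegrable_iff_integrableOn_Ioo_of_le zero_le_one]; exact hf

theorem prim_ac {f : ℝ → ℝ} (hf : Integrable f (volIoo 0 1)) :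
    AbsolutelyContinuousOnInterval (prim f) 0 1 :=
  (intervalIntegrable_of_volIoo hf).absolutelyContinuousOnInterval_intervalIntegral (by simp)

/-- Integration by parts for the absolutely continuous primitive. It vanishes at 0, so `u` needs to
vanish only at 1; this admits u(s) = s - 1 as well as test functions. -/
theorem integral_mul_prim {f u : ℝ → ℝ} (hf : Integrable f (volIoo 0 1)) (hu : ContDiff ℝ 1 u)
    (h1 : u 1 = 0) :
    ∫ s, deriv u s * prim f s ∂volIoo 0 1 = - ∫ s, u s * f s ∂volIoo 0 1 := by
  rw [integral_volIoo, integral_volIoo]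
  have := (prim_ac hf).integral_mul_deriv_eq_deriv_mul
    (hu.contDiffOn.absolutelyContinuousOnInterval (f := u) (a := 0) (b := 1))
  have h2 : ∫ x in (0 : ℝ)..1, deriv (prim f) x * u x = ∫ x in (0 : ℝ)..1, u x * f x := by
    apply intervalIntegral.integral_congr_ae
    filter_upwards [(intervalIntegrable_of_volIoo hf).ae_hasDerivAt_integral] with x hx hx'
    have h3 : HasDerivAt (prim f) (f x) x := hx (uIoc_subset_uIcc hx') 0 (by simp)
    rw [h3.deriv, mul_comm]
  have h0 : prim f 0 = 0 := by simp [prim]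
  rw [h1, h0, h2] at this
  simp only [mul_comm (deriv u _)]
  linarith

/-- The lemma of du Bois-Reymond on `(0, 1)`. -/
theorem ae_eq_const_of_integral_deriv_mul {k : ℝ → ℝ} (hk : Integrable k (volIoo 0 1))
    (h : ∀ ζ, IsTestOn (Ioo 0 1) ζ → ∫ s, deriv ζ s * k s ∂volIoo 0 1 = 0) :
    ∀ᵐ s ∂volIoo 0 1, k s = ∫ r, k r ∂volIoo 0 1 := by
  -- A fixed test function of unit integral; the support [1/4, 3/4] lies inside (0, 1).
  let χ₀ : ContDiffBump (1 / 2 : ℝ) := ⟨1 / 8, 1 / 4, by norm_num, by norm_num⟩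
  set χ := χ₀.normed volume with hχ
  have hχt : IsTestOn (Ioo 0 1) χ := by
    refine ⟨χ₀.contDiff_normed, χ₀.hasCompactSupport_normed, ?_⟩
    rw [χ₀.tsupport_normed_eq, Real.closedBall_eq_Icc]
    intro x hx
    simp only [χ₀, mem_Icc, mem_Ioo] at hx ⊢
    constructor <;> linarith [hx.1, hx.2]
  have hmul {ξ : ℝ → ℝ} (hξ : IsTestOn (Ioo 0 1) ξ) : Integrable (fun s => ξ s * k s)
      (volIoo 0 1) := by
    obtain ⟨C, hC⟩ := hξ.contDiff.continuous.bounded_above_of_compact_support hξ.hasCompactSupport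
    exact hk.bdd_mul hξ.contDiff.continuous.aestronglyMeasurable (Eventually.of_forall hC)
  have hint {ξ : ℝ → ℝ} (hξ : IsTestOn (Ioo 0 1) ξ) : ∫ s in (0 : ℝ)..1, ξ s = ∫ s, ξ s := by
    rw [← integral_volIoo]
    exact setIntegral_eq_integral_of_forall_compl_eq_zero fun x hx => hξ.eq_zero hx
  set c := ∫ s, χ s * k s ∂volIoo 0 1
  have key : ∀ ξ, IsTestOn (Ioo 0 1) ξ → ∫ s, ξ s * (k s - c) ∂volIoo 0 1 = 0 := by
    intro ξ hξ
    set m := ∫ s, ξ s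
    -- Subtracting m χ makes the integral vanish, so the primitive of `w` is again compactly
    -- supported and is an admissible test function.
    set w : ℝ → ℝ := fun s => ξ s - m * χ s with hw
    have hwc : ContDiff ℝ (⊤ : ℕ∞) w := hξ.contDiff.sub (contDiff_const.mul hχt.contDiff)
    set ζ := prim w with hζ
    have hd : ∀ s, HasDerivAt ζ (w s) s := fun s =>
      intervalIntegral.integral_hasDerivAt_right (hwc.continuous.intervalIntegrable _ _)
        hwc.continuous.stronglyMeasurable.stronglyMeasurableAtFilter hwc.continuous.continuousAt
    have hdz : deriv ζ = w := funext fun s => (hd s).deriv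
    have hζc : ContDiff ℝ (⊤ : ℕ∞) ζ := by
      rw [contDiff_infty_iff_deriv, hdz]
      exact ⟨fun s => (hd s).differentiableAt, hwc⟩
    have hχ1 : ∫ s, χ s = 1 := χ₀.integral_normed
    have hw1 : ∫ s in (0 : ℝ)..1, w s = 0 := by
      have hχi : IntervalIntegrable (fun s => m * χ s) volume 0 1 :=
        (continuous_const.mul hχt.contDiff.continuous).intervalIntegrable _ _
      simp only [hw]
      rw [intervalIntegral.integral_sub (hξ.contDiff.continuous.intervalIntegrable _ _) hχi,
        intervalIntegral.integral_const_mul, hint hξ, hint hχt, hχ1]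
      simp [m]
    set K := tsupport ξ ∪ tsupport χ with hK
    have hKc : IsCompact K := hξ.hasCompactSupport.union hχt.hasCompactSupport
    have hKs : K ⊆ Ioo 0 1 := union_subset hξ.tsupport_subset hχt.tsupport_subset
    have hwK : ∀ s, s ∉ K → w s = 0 := by
      intro s hs
      simp only [hK, mem_union, not_or] at hs
      simp [hw, image_eq_zero_of_notMem_tsupport hs.1, image_eq_zero_of_notMem_tsupport hs.2]
    have hKne : K.Nonempty := by
      refine ⟨1 / 2, Or.inr ?_⟩
      rw [hχ, χ₀.tsupport_normed_eq]
      exact Metric.mem_closedBall_self (by norm_num [χ₀])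
    obtain ⟨p, hpK, hp⟩ := hKc.exists_isLeast hKne
    obtain ⟨q, hqK, hq⟩ := hKc.exists_isGreatest hKne
    have hp0 := hKs hpK
    have hq0 := hKs hqK
    have hzero : ∀ s, s ∉ Icc p q → ζ s = 0 := by
      intro s hs
      rw [mem_Icc, not_and_or, not_le, not_le] at hs
      rcases hs with hs | hs
      · refine (intervalIntegral.integral_congr (g := fun _ => 0) fun t ht => hwK t fun htK => ?_).trans
          (by simp)
        have := ht.2
        have h5 := hp htK
        rcases max_cases 0 s with h6 | h6 <;> rw [h6.1] at this <;> linarith [hp0.1]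
      -- To the right of the supports the primitive equals the total integral of `w`, which is zero.
      · have h7 : ζ s = (∫ t in (0 : ℝ)..1, w t) + ∫ t in (1 : ℝ)..s, w t :=
          (intervalIntegral.integral_add_adjacent_intervals
            (hwc.continuous.intervalIntegrable _ _) (hwc.continuous.intervalIntegrable _ _)).symm
        rw [h7, hw1, zero_add]
        refine (intervalIntegral.integral_congr (g := fun _ => 0) fun t ht => hwK t fun htK => ?_).trans
          (by simp)
        have := ht.1
        have h5 := hq htK
        rcases min_cases 1 s with h6 | h6 <;> rw [h6.1] at this <;> linarith [hq0.2]
    have hsub : tsupport ζ ⊆ Icc p q := closure_minimal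
      (fun s hs => by_contra fun h' => hs (hzero s h')) isClosed_Icc
    have := h ζ ⟨hζc, HasCompactSupport.intro isCompact_Icc hzero,
      hsub.trans fun s hs => ⟨hp0.1.trans_le hs.1, hs.2.trans_lt hq0.2⟩⟩
    rw [hdz] at this
    have e1 : ∀ s, w s * k s = ξ s * k s - m * (χ s * k s) := fun s => by simp only [hw]; ring
    simp only [e1] at this
    rw [integral_sub (hmul hξ) ((hmul hχt).const_mul m), integral_const_mul] at this
    simp only [mul_sub]
    rw [integral_sub (hmul hξ) ((hξ.contDiff.continuous.integrable_of_hasCompactSupport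
      hξ.hasCompactSupport).restrict.mul_const c), integral_mul_const]
    have : ∫ s, ξ s ∂volIoo 0 1 = m := by rw [integral_volIoo, hint hξ]
    rw [this]
    linarith
  have hae : ∀ᵐ s, s ∈ Ioo (0 : ℝ) 1 → k s - c = 0 := by
    refine isOpen_Ioo.ae_eq_zero_of_integral_contDiff_smul_eq_zero
      (IntegrableOn.locallyIntegrableOn ?_) fun ξ h1 h2 h3 => ?_
    · exact Integrable.sub (f := k) hk (integrable_const c)
    · have hξ : IsTestOn (Ioo 0 1) ξ := ⟨h1, h2, h3⟩
      have := key ξ hξ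
      rw [← setIntegral_eq_integral_of_forall_compl_eq_zero (s := Ioo (0 : ℝ) 1)]
      · exact this
      · intro x hx; simp [hξ.eq_zero hx]
  have hae' : ∀ᵐ s ∂volIoo 0 1, k s = c := by
    rw [ae_restrict_iff' measurableSet_Ioo]
    filter_upwards [hae] with s hs h using sub_eq_zero.1 (hs h)
  have hc : ∫ r, k r ∂volIoo 0 1 = c := by
    rw [integral_congr_ae hae']; simp
  rw [hc]; exact hae'

/-- By du Bois-Reymond f - `prim h` is constant. An integration by parts writes its mean without the
primitive, as an integral linear in f and h. Over ω this turns the integration constants into kernel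
integrals, hence smooth functions of x₁. -/
theorem ae_eq_add_prim {f h : ℝ → ℝ} (hf : Integrable f (volIoo 0 1))
    (hh : Integrable h (volIoo 0 1))
    (hw : ∀ ζ, IsTestOn (Ioo 0 1) ζ →
      ∫ s, deriv ζ s * f s ∂volIoo 0 1 = -∫ s, ζ s * h s ∂volIoo 0 1) :
    ∀ᵐ s ∂volIoo 0 1, f s = (∫ r, (f r - (1 - r) * h r) ∂volIoo 0 1) + prim h s := by
  have hp : Integrable (prim h) (volIoo 0 1) := by
    have := (prim_ac hh).continuousOn
    rw [uIcc_of_le zero_le_one] at this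
    exact (this.integrableOn_Icc).mono_set Ioo_subset_Icc_self
  have h1 : ∀ᵐ s ∂volIoo 0 1, f s - prim h s = ∫ r, (f r - prim h r) ∂volIoo 0 1 := by
    refine ae_eq_const_of_integral_deriv_mul (hf.sub hp) fun ζ hζ => ?_
    have e := integral_mul_prim hh (hζ.contDiff.of_le (by norm_cast))
      (hζ.eq_zero (by simp))
    obtain ⟨C, hC⟩ := hζ.deriv.contDiff.continuous.bounded_above_of_compact_support
      hζ.deriv.hasCompactSupport
    have hm := hζ.deriv.contDiff.continuous.aestronglyMeasurable (μ := volIoo 0 1)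
    simp only [mul_sub]
    rw [integral_sub (hf.bdd_mul hm (Eventually.of_forall hC))
      (hp.bdd_mul hm (Eventually.of_forall hC)), e, hw ζ hζ, sub_self]
  -- Here u(s) = s - 1 vanishes at 1 and has derivative 1.
  have h2 : ∫ r, prim h r ∂volIoo 0 1 = ∫ r, (1 - r) * h r ∂volIoo 0 1 := by
    have := integral_mul_prim hh (u := fun s => s - 1) (by fun_prop) (by simp)
    simp only [deriv_sub_const_fun, deriv_id'', one_mul] at this
    rw [this, ← integral_neg]
    congr 1; ext s; ring
  have h3 : Integrable (fun r => (1 - r) * h r) (volIoo 0 1) := by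
    refine hh.bdd_mul (c := 1) (by fun_prop) ?_
    filter_upwards [ae_restrict_mem measurableSet_Ioo] with r hr
    rw [Real.norm_eq_abs, abs_le]; constructor <;> linarith [hr.1, hr.2]
  filter_upwards [h1] with s hs
  rw [integral_sub hf h3, ← h2, ← integral_sub hf hp, ← hs]; ring

/-! ### Integration over the lines s = const -/

/-- The integral of `F` over the lines `s = const`. -/
noncomputable def lineInt (L : ℝ) (F : ℝ × ℝ → ℝ) (s : ℝ) : ℝ := ∫ y, F (y, s) ∂volIoo 0 L

theorem integrable_lineInt {L : ℝ} {F : ℝ × ℝ → ℝ} (hF : Integrable F (volOmega L)) :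
    Integrable (lineInt L F) (volIoo 0 1) := by
  rw [volOmega_eq_prod] at hF
  exact hF.integral_prod_right

theorem integral_mul_lineInt {L : ℝ} {F : ℝ × ℝ → ℝ} {ζ : ℝ → ℝ}
    (hF : Integrable (fun p => ζ p.2 * F p) (volOmega L)) :
    ∫ s, ζ s * lineInt L F s ∂volIoo 0 1 = ∫ p, ζ p.2 * F p ∂volOmega L := by
  rw [volOmega_eq_prod] at hF ⊢
  rw [integral_prod_symm _ hF]
  simp only [lineInt, integral_const_mul]

theorem integrable_mul_snd {L : ℝ} {F : ℝ × ℝ → ℝ} (hF : Integrable F (volOmega L)) {u : ℝ → ℝ}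
    (hu : Continuous u) : Integrable (fun p => u p.2 * F p) (volOmega L) := by
  obtain ⟨C, hC⟩ := isCompact_Icc.exists_bound_of_continuousOn (s := Icc (0 : ℝ) 1) hu.continuousOn
  refine hF.bdd_mul (c := C) (hu.comp continuous_snd).aestronglyMeasurable ?_
  filter_upwards [ae_restrict_mem (omega L).isOpen.measurableSet] with p hp
  exact hC p.2 (Ioo_subset_Icc_self hp.2)

/-- A weak `s`-derivative on `ω`, integrated over lines. -/
theorem lineInt_ae_eq {L : ℝ} {F H : ℝ × ℝ → ℝ} (hF : Integrable F (volOmega L))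
    (hH : Integrable H (volOmega L))
    (hw : ∀ ζ, IsTestOn (Ioo 0 1) ζ →
      ∫ p, deriv ζ p.2 * F p ∂volOmega L = -∫ p, ζ p.2 * H p ∂volOmega L) :
    ∀ᵐ s ∂volIoo 0 1, lineInt L F s =
      (∫ p, (F p - (1 - p.2) * H p) ∂volOmega L) + prim (lineInt L H) s := by
  have hc : Continuous fun s : ℝ => 1 - s := by fun_prop
  have h := ae_eq_add_prim (integrable_lineInt hF) (integrable_lineInt hH) fun ζ hζ => by
    rw [integral_mul_lineInt (integrable_mul_snd hF hζ.deriv.contDiff.continuous),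
      integral_mul_lineInt (integrable_mul_snd hH hζ.contDiff.continuous), hw ζ hζ]
  have e : ∫ r, (lineInt L F r - (1 - r) * lineInt L H r) ∂volIoo 0 1 =
      ∫ p, (F p - (1 - p.2) * H p) ∂volOmega L := by
    have h1 := integral_mul_lineInt (ζ := fun s => 1 - s) (integrable_mul_snd hH hc)
    have h2 := integral_mul_lineInt (F := F) (ζ := fun s => 1) (L := L) (by simpa using hF)
    simp only [one_mul] at h2
    rw [integral_sub hF (integrable_mul_snd hH hc), ← h1, ← h2, integral_sub
      (integrable_lineInt hF)]
    have h3 := (integrable_mul_snd hH hc)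
    rw [volOmega_eq_prod] at h3
    have := h3.integral_prod_right
    simp only [integral_const_mul] at this
    exact this
  rw [e] at h
  exact h

theorem IsTestOn.exists_bound {U : Set ℝ} {ψ : ℝ → ℝ} (h : IsTestOn U ψ) :
    ∃ C, 0 ≤ C ∧ ∀ x, |ψ x| ≤ C := by
  obtain ⟨C, hC⟩ := h.contDiff.continuous.bounded_above_of_compact_support h.hasCompactSupport
  exact ⟨C, (norm_nonneg _).trans (hC 0), hC⟩

/-! ### Smoothness of kernel integrals in the parameter -/

section Parametric

variable {Ω : Type*} [MeasurableSpace Ω] {ν : Measure Ω} {F u : Ω → ℝ} {U : Set ℝ} {k : ℝ → ℝ}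

theorem integrable_kernel_mul (hF : Integrable F ν) (hu : AEStronglyMeasurable u ν)
    (hk : IsTestOn U k) (x : ℝ) : Integrable (fun w => k (x - u w) * F w) ν := by
  obtain ⟨C, -, hC⟩ := hk.exists_bound
  exact hF.bdd_mul (hk.contDiff.continuous.comp_aestronglyMeasurable
    (aestronglyMeasurable_const.sub hu)) (Eventually.of_forall fun w => hC _)

/-- Differentiation under the integral, dominated by |a| sup|k'| |F|. The map `u` will be either the
first coordinate on ω or the identity on (0, L); the affine argument a x + c accommodates the
contraction. -/
theorem hasDerivAt_kernel_integral (hF : Integrable F ν) (hu : AEStronglyMeasurable u ν)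
    (hk : IsTestOn U k) (a c x : ℝ) :
    HasDerivAt (fun x => ∫ w, k (a * x + c - u w) * F w ∂ν)
      (a * ∫ w, deriv k (a * x + c - u w) * F w ∂ν) x := by
  obtain ⟨C, -, hC⟩ := hk.deriv.exists_bound
  rw [← integral_const_mul]
  refine (hasDerivAt_integral_of_dominated_loc_of_deriv_le
    (F := fun x w => k (a * x + c - u w) * F w)
    (F' := fun x w => a * (deriv k (a * x + c - u w) * F w))
    (bound := fun w => |a| * C * |F w|) univ_mem
    (Eventually.of_forall fun y => (integrable_kernel_mul hF hu hk _).aestronglyMeasurable)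
    (integrable_kernel_mul hF hu hk _)
    ((integrable_kernel_mul hF hu hk.deriv _).const_mul a).aestronglyMeasurable
    (Eventually.of_forall fun w y _ => ?_) (hF.abs.const_mul _)
    (Eventually.of_forall fun w y _ => ?_)).2
  · rw [Real.norm_eq_abs, abs_mul, abs_mul, ← mul_assoc]
    gcongr
    exact hC _
  · have h1 : HasDerivAt (fun y => a * y + c - u w) a y := by
      simpa using (((hasDerivAt_id y).const_mul a).add_const c).sub_const (u w)
    have := ((hk.hasDerivAt (a * y + c - u w)).comp y h1).mul_const (F w)
    exact this.congr_deriv (by ring)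

theorem contDiff_kernel_integral (hF : Integrable F ν) (hu : AEStronglyMeasurable u ν)
    (hk : IsTestOn U k) (a c : ℝ) :
    ContDiff ℝ (⊤ : ℕ∞) (fun x => ∫ w, k (a * x + c - u w) * F w ∂ν) := by
  rw [contDiff_infty]
  intro n
  induction n generalizing k with
  | zero =>
    exact contDiff_zero.2 (continuous_iff_continuousAt.2 fun x =>
      (hasDerivAt_kernel_integral hF hu hk a c x).continuousAt)
  | succ n ih =>
    push_cast
    rw [contDiff_succ_iff_deriv]
    refine ⟨fun x => (hasDerivAt_kernel_integral hF hu hk a c x).differentiableAt, by simp, ?_⟩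
    rw [funext fun x => (hasDerivAt_kernel_integral hF hu hk a c x).deriv]
    exact contDiff_const.mul (ih hk.deriv)

end Parametric

/-! ### Mollifiers at contracted points -/

/-- `η` is a mollifier whose translates to the points `lam * x + c`, `x ∈ [0, L]`, live in
`(0, L)`, at distance at most `δ` from `x`. -/
structure IsMollifier (L δ lam c : ℝ) (η : ℝ → ℝ) : Prop where
  isTestOn : IsTestOn univ η
  nonneg : ∀ x, 0 ≤ η x
  integral_eq_one : ∫ x, η x = 1
  slice : ∀ x ∈ Icc 0 L, tsupport (fun y => η (lam * x + c - y)) ⊆ Ioo 0 L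
  near : ∀ x ∈ Icc 0 L, ∀ y, η (lam * x + c - y) ≠ 0 → |x - y| ≤ δ
  half_le : 1 / 2 ≤ lam
  le_one : lam ≤ 1
  one_sub_le : 1 - δ ≤ lam

theorem IsMollifier.isTestOn_slice {L δ lam c : ℝ} {η : ℝ → ℝ} (h : IsMollifier L δ lam c η)
    {x : ℝ} (hx : x ∈ Icc 0 L) : IsTestOn (Ioo 0 L) (fun y => η (lam * x + c - y)) where
  contDiff := h.isTestOn.contDiff.comp (contDiff_const.sub contDiff_id)
  hasCompactSupport :=
    h.isTestOn.hasCompactSupport.comp_homeomorph (Homeomorph.subLeft (lam * x + c))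
  tsupport_subset := h.slice x hx

/-- The map x ↦ (1 - t)x + tL/2 contracts [0, L] towards its midpoint and leaves a margin tL/2 at
both ends, while η has support of radius tL/4. The displacement is at most tL/2 + tL/4 ≤ tL ≤ δ. -/
theorem exists_isMollifier {L δ : ℝ} (hL : 0 < L) (hδ : 0 < δ) :
    ∃ lam c η, IsMollifier L δ lam c η := by
  set t := min (1 / 2) (min δ (δ / L)) with ht
  have ht0 : 0 < t := by positivity
  have ht1 : t ≤ 1 / 2 := min_le_left _ _
  have ht2 : t ≤ δ := (min_le_right _ _).trans (min_le_left _ _)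
  have ht3 : t * L ≤ δ := by
    have : t ≤ δ / L := (min_le_right _ _).trans (min_le_right _ _)
    rwa [le_div_iff₀ hL] at this
  have htL : 0 < t * L := by positivity
  let χ : ContDiffBump (0 : ℝ) := ⟨t * L / 8, t * L / 4, by positivity, by linarith⟩
  have hz : ∀ z, z ∈ tsupport (χ.normed volume) → |z| ≤ t * L / 4 := by
    intro z hz
    rw [χ.tsupport_normed_eq] at hz
    simpa using hz
  refine ⟨1 - t, t * L / 2, χ.normed volume, ⟨χ.contDiff_normed, χ.hasCompactSupport_normed,
    subset_univ _⟩, χ.nonneg_normed, χ.integral_normed, ?_, ?_, by linarith, by linarith,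
    by linarith⟩
  · intro x hx y hy
    have h1 := hz _ (tsupport_comp_subset_preimage (χ.normed volume)
      (f := fun y => (1 - t) * x + t * L / 2 - y) (by fun_prop) hy)
    rw [abs_le] at h1
    have := mul_nonneg (by linarith : 0 ≤ 1 - t) hx.1
    have := mul_le_mul_of_nonneg_left hx.2 (by linarith : 0 ≤ 1 - t)
    constructor <;> nlinarith [h1.1, h1.2]
  · intro x hx y hy
    have h1 := hz _ (subset_tsupport _ hy)
    have := mul_nonneg ht0.le hx.1
    have := mul_le_mul_of_nonneg_left hx.2 ht0.le
    rw [abs_le] at h1 ⊢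
    constructor <;> nlinarith [h1.1, h1.2]

/-- Weighted averages of `F` in the first variable, with weight `k (lam * x + c - ·)` at `x`. -/
noncomputable def average (L lam c : ℝ) (k : ℝ → ℝ) (F : ℝ × ℝ → ℝ) (p : ℝ × ℝ) : ℝ :=
  lineInt L (fun q => k (lam * p.1 + c - q.1) * F q) p.2

theorem stronglyMeasurable_average {L lam c : ℝ} {k : ℝ → ℝ} (hk : Continuous k)
    {F : ℝ × ℝ → ℝ} (hF : Measurable F) : StronglyMeasurable (average L lam c k F) := by
  have : Measurable fun q : (ℝ × ℝ) × ℝ => k (lam * q.1.1 + c - q.2) * F (q.2, q.1.2) := by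
    have := hk.measurable
    fun_prop
  exact this.stronglyMeasurable.integral_prod_right' (ν := volIoo 0 L)

/-! ### Uniform L² bound for averages -/

section Schur

variable {L δ lam c : ℝ} {η : ℝ → ℝ}

theorem IsMollifier.integral_slice (h : IsMollifier L δ lam c η) {x : ℝ} (hx : x ∈ Icc 0 L) :
    ∫ y, η (lam * x + c - y) ∂volIoo 0 L = 1 := by
  rw [setIntegral_eq_integral_of_forall_compl_eq_zero
    fun y hy => (h.isTestOn_slice hx).eq_zero hy, integral_sub_left_eq_self (f := η) (μ := volume),
    h.integral_eq_one]

theorem IsMollifier.integrable (h : IsMollifier L δ lam c η) : Integrable η :=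
  h.isTestOn.contDiff.continuous.integrable_of_hasCompactSupport h.isTestOn.hasCompactSupport

theorem IsMollifier.lintegral_slice (h : IsMollifier L δ lam c η) {x : ℝ} (hx : x ∈ Icc 0 L) :
    ∫⁻ y, ‖η (lam * x + c - y)‖ₑ ∂volIoo 0 L = 1 := by
  have hi : Integrable (fun y => η (lam * x + c - y)) (volIoo 0 L) :=
    (h.integrable.comp_sub_left _).restrict
  rw [← ofReal_integral_norm_eq_lintegral_enorm hi]
  simp only [Real.norm_of_nonneg (h.nonneg _)]
  rw [h.integral_slice hx, ENNReal.ofReal_one]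

theorem IsMollifier.lintegral_slice_left (h : IsMollifier L δ lam c η) (y : ℝ) :
    ∫⁻ x, ‖η (lam * x + c - y)‖ₑ ∂volIoo 0 L ≤ 2 := by
  have hl : 0 < lam := by linarith [h.half_le]
  refine (setLIntegral_le_lintegral _ _).trans ?_
  have h0 : Integrable (fun x => η (x + (c - y))) := h.integrable.comp_add_right _
  have hi : Integrable (fun x => η (lam * x + c - y)) := by
    have := h0.comp_mul_left' hl.ne'
    simpa only [add_sub_assoc] using this
  rw [← ofReal_integral_norm_eq_lintegral_enorm hi]
  simp only [Real.norm_of_nonneg (h.nonneg _)]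
  have e := Measure.integral_comp_mul_left (fun x => η (x + (c - y))) lam
  rw [integral_add_right_eq_self (μ := volume) η, h.integral_eq_one] at e
  simp only [add_sub_assoc]
  rw [e, abs_of_pos (inv_pos.2 hl), smul_eq_mul, mul_one]
  refine ENNReal.ofReal_le_of_le_toReal ?_
  rw [ENNReal.toReal_ofNat]
  exact inv_le_of_inv_le₀ (by norm_num) (by linarith [h.half_le])

/-- Cauchy-Schwarz with the weight split as η^(1/2) · η^(1/2), the total mass of η being 1. -/
theorem IsMollifier.enorm_average_sq_le (h : IsMollifier L δ lam c η) {F : ℝ × ℝ → ℝ}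
    (hF : Measurable F) {p : ℝ × ℝ} (hp : p.1 ∈ Icc 0 L) :
    ‖average L lam c η F p‖ₑ ^ (2 : ℝ) ≤
      ∫⁻ y, ‖η (lam * p.1 + c - y)‖ₑ * ‖F (y, p.2)‖ₑ ^ (2 : ℝ) ∂volIoo 0 L := by
  have hη := h.isTestOn.contDiff.continuous.measurable
  have h1 : ‖average L lam c η F p‖ₑ ≤
      ∫⁻ y, ‖η (lam * p.1 + c - y)‖ₑ * ‖F (y, p.2)‖ₑ ∂volIoo 0 L := by
    refine (enorm_integral_le_lintegral_enorm _).trans_eq ?_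
    simp only [enorm_mul]
  have h2 := ENNReal.lintegral_mul_norm_pow_le (μ := volIoo 0 L) (p := 1 / 2) (q := 1 / 2)
    (f := fun y => ‖η (lam * p.1 + c - y)‖ₑ)
    (g := fun y => ‖η (lam * p.1 + c - y)‖ₑ * ‖F (y, p.2)‖ₑ ^ (2 : ℝ))
    (by fun_prop) (by fun_prop) (by norm_num) (by norm_num) (by norm_num)
  rw [h.lintegral_slice hp, ENNReal.one_rpow, one_mul] at h2
  have e : ∀ y, ‖η (lam * p.1 + c - y)‖ₑ ^ (1 / 2 : ℝ) *
      (‖η (lam * p.1 + c - y)‖ₑ * ‖F (y, p.2)‖ₑ ^ (2 : ℝ)) ^ (1 / 2 : ℝ) =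
      ‖η (lam * p.1 + c - y)‖ₑ * ‖F (y, p.2)‖ₑ := by
    intro y
    rw [ENNReal.mul_rpow_of_nonneg _ _ (by norm_num), ← mul_assoc, ← ENNReal.rpow_add_of_nonneg _ _
      (by norm_num) (by norm_num), ← ENNReal.rpow_mul]
    norm_num
  simp only [e] at h2
  refine (ENNReal.rpow_le_rpow (h1.trans h2) (by norm_num)).trans_eq ?_
  rw [← ENNReal.rpow_mul]
  norm_num

/-- Schur's test: the kernel has mass 1 in y, and mass at most 1/lam ≤ 2 in x by the change of
variables. -/
theorem IsMollifier.eLpNorm_average_le (h : IsMollifier L δ lam c η) {F : ℝ × ℝ → ℝ}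
    (hF : Measurable F) :
    eLpNorm (average L lam c η F) 2 (volOmega L) ≤ 2 * eLpNorm F 2 (volOmega L) := by
  have hη := h.isTestOn.contDiff.continuous.measurable
  rw [eLpNorm_eq_lintegral_rpow_enorm_toReal (by norm_num) (by norm_num),
    eLpNorm_eq_lintegral_rpow_enorm_toReal (by norm_num) (by norm_num)]
  simp only [ENNReal.toReal_ofNat]
  -- The squared norms satisfy the bound with constant 2; it is relaxed to 4, whose square root is
  -- simple.
  have h4 : (2 : ℝ≥0∞) = (4 : ℝ≥0∞) ^ (1 / 2 : ℝ) := by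
    rw [show (4 : ℝ≥0∞) = 2 ^ (2 : ℝ) by norm_num, ← ENNReal.rpow_mul]; norm_num
  conv_rhs => rw [h4]
  rw [← ENNReal.mul_rpow_of_nonneg _ _ (by norm_num)]
  refine ENNReal.rpow_le_rpow ?_ (by norm_num)
  calc ∫⁻ p, ‖average L lam c η F p‖ₑ ^ (2 : ℝ) ∂volOmega L
      ≤ ∫⁻ p, ∫⁻ y, ‖η (lam * p.1 + c - y)‖ₑ * ‖F (y, p.2)‖ₑ ^ (2 : ℝ) ∂volIoo 0 L
          ∂volOmega L := by
        refine lintegral_mono_ae ?_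
        filter_upwards [ae_restrict_mem (omega L).isOpen.measurableSet] with p hp
        exact h.enorm_average_sq_le hF (Ioo_subset_Icc_self hp.1)
    _ ≤ ∫⁻ x, ∫⁻ s, ∫⁻ y, ‖η (lam * x + c - y)‖ₑ * ‖F (y, s)‖ₑ ^ (2 : ℝ) ∂volIoo 0 L
          ∂volIoo 0 1 ∂volIoo 0 L := by
        rw [volOmega_eq_prod]; exact lintegral_prod_le _
    _ = ∫⁻ x, ∫⁻ y, ‖η (lam * x + c - y)‖ₑ * ∫⁻ s, ‖F (y, s)‖ₑ ^ (2 : ℝ) ∂volIoo 0 1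
          ∂volIoo 0 L ∂volIoo 0 L := by
        congr 1; ext x
        rw [lintegral_lintegral_swap (by fun_prop)]
        congr 1; ext y
        rw [lintegral_const_mul _ (by fun_prop)]
    _ = ∫⁻ y, (∫⁻ x, ‖η (lam * x + c - y)‖ₑ ∂volIoo 0 L) * ∫⁻ s, ‖F (y, s)‖ₑ ^ (2 : ℝ)
          ∂volIoo 0 1 ∂volIoo 0 L := by
        have hm : Measurable fun y => ∫⁻ s, ‖F (y, s)‖ₑ ^ (2 : ℝ) ∂volIoo 0 1 :=
          Measurable.lintegral_prod_right' (f := fun q : ℝ × ℝ => ‖F q‖ₑ ^ (2 : ℝ)) (by fun_prop)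
        rw [lintegral_lintegral_swap (by fun_prop)]
        congr 1; ext y
        rw [lintegral_mul_const _ (by fun_prop)]
    _ ≤ ∫⁻ y, 2 * ∫⁻ s, ‖F (y, s)‖ₑ ^ (2 : ℝ) ∂volIoo 0 1 ∂volIoo 0 L := by
        gcongr with y
        exact h.lintegral_slice_left y
    _ = 2 * ∫⁻ p, ‖F p‖ₑ ^ (2 : ℝ) ∂volOmega L := by
        rw [lintegral_const_mul' _ _ (by norm_num), volOmega_eq_prod, lintegral_prod _ (by fun_prop)]
    _ ≤ 4 * ∫⁻ p, ‖F p‖ₑ ^ (2 : ℝ) ∂volOmega L := by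
        gcongr; norm_num

end Schur

/-! ### Approximation in L²(ω) -/

instance isFiniteMeasure_volOmega (L : ℝ) : IsFiniteMeasure (volOmega L) := by
  rw [volOmega_eq_prod]; infer_instance

theorem ae_mem_omega (L : ℝ) : ∀ᵐ p ∂volOmega L, p ∈ (omega L : Set (ℝ × ℝ)) :=
  ae_restrict_mem (omega L).isOpen.measurableSet

theorem ae_snd {L : ℝ} {q : ℝ → Prop} (h : ∀ᵐ s ∂volIoo 0 1, q s) :
    ∀ᵐ p ∂volOmega L, q p.2 := by
  rw [volOmega_eq_prod]
  exact Measure.quasiMeasurePreserving_snd.ae h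

theorem ae_integrable_line {L : ℝ} {F : ℝ × ℝ → ℝ} (hF : Integrable F (volOmega L)) :
    ∀ᵐ s ∂volIoo 0 1, Integrable (fun y => F (y, s)) (volIoo 0 L) := by
  rw [volOmega_eq_prod] at hF
  exact hF.prod_left_ae

theorem eLpNorm_le_of_forall {L : ℝ} {f : ℝ × ℝ → ℝ} {C : ℝ}
    (h : ∀ᵐ p ∂volOmega L, |f p| ≤ C) :
    eLpNorm f 2 (volOmega L) ≤ (volOmega L univ) ^ (1 / 2 : ℝ) * ENNReal.ofReal C := by
  have := eLpNorm_le_of_ae_bound (p := 2) (f := f) (C := C) h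
  simpa using this

/-- Given `κ`, a constant `C` with `‖f‖₂ ≤ κ` for every `f` bounded by `C` on `ω`. -/
theorem exists_bound_eLpNorm_le (L : ℝ) {κ : ℝ≥0∞} (hκ : κ ≠ 0) :
    ∃ C : ℝ, 0 < C ∧ ∀ f : ℝ × ℝ → ℝ, (∀ᵐ p ∂volOmega L, |f p| ≤ C) →
      eLpNorm f 2 (volOmega L) ≤ κ := by
  have hV : (volOmega L univ) ^ (1 / 2 : ℝ) ≠ ⊤ :=
    ENNReal.rpow_ne_top_of_nonneg (by norm_num) (measure_ne_top _ _)
  have hV1 : (volOmega L univ) ^ (1 / 2 : ℝ) + 1 ≠ ⊤ := by simp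
  set C' := min 1 (κ / ((volOmega L univ) ^ (1 / 2 : ℝ) + 1)) with hC'
  have h0 : C' ≠ 0 := by
    simp [hC', ENNReal.div_eq_zero_iff, hκ, min_eq_iff]
  have h1 : C' ≠ ⊤ := ne_top_of_le_ne_top ENNReal.one_ne_top (min_le_left _ _)
  refine ⟨C'.toReal, ENNReal.toReal_pos h0 h1, fun f hf => (eLpNorm_le_of_forall hf).trans ?_⟩
  rw [ENNReal.ofReal_toReal h1]
  calc _ ≤ ((volOmega L univ) ^ (1 / 2 : ℝ) + 1) *
        (κ / ((volOmega L univ) ^ (1 / 2 : ℝ) + 1)) := by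
        gcongr
        · exact le_self_add
        · exact min_le_right _ _
    _ = κ := ENNReal.mul_div_cancel (by simp) hV1

theorem exists_continuous_eLpNorm_sub_le {L : ℝ} {F : ℝ × ℝ → ℝ}
    (hF : MemLp F 2 (volOmega L)) {κ : ℝ≥0∞} (hκ : κ ≠ 0) :
    ∃ h : ℝ × ℝ → ℝ, HasCompactSupport h ∧ Continuous h ∧
      eLpNorm (fun p => F p - h p) 2 (volOmega L) ≤ κ := by
  have hm := (omega L).isOpen.measurableSet
  have h1 : MemLp (indicator (omega L : Set (ℝ × ℝ)) F) 2 volume :=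
    (memLp_indicator_iff_restrict hm).2 hF
  obtain ⟨h, hc, hle, hcont, -⟩ := h1.exists_hasCompactSupport_eLpNorm_sub_le (by norm_num) hκ
  refine ⟨h, hc, hcont, le_trans ?_ hle⟩
  refine le_trans (le_of_eq ?_) (eLpNorm_mono_measure _ (Measure.restrict_le_self
    (s := (omega L : Set (ℝ × ℝ)))))
  refine eLpNorm_congr_ae ?_
  filter_upwards [ae_mem_omega L] with p hp
  simp [indicator_of_mem hp]

theorem average_sub_ae {L lam c : ℝ} {k : ℝ → ℝ} (hk : IsTestOn univ k) {F G : ℝ × ℝ → ℝ}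
    (hF : Integrable F (volOmega L)) (hG : Integrable G (volOmega L)) :
    ∀ᵐ p ∂volOmega L, average L lam c k (fun q => F q - G q) p =
      average L lam c k F p - average L lam c k G p := by
  filter_upwards [ae_snd (ae_integrable_line hF), ae_snd (ae_integrable_line hG)] with p h1 h2
  simp only [average, lineInt, mul_sub]
  exact integral_sub (integrable_kernel_mul h1 measurable_id.aestronglyMeasurable hk _)
    (integrable_kernel_mul h2 measurable_id.aestronglyMeasurable hk _)

/-- Averages converge in `L²` as the mollifier concentrates. -/
theorem exists_eLpNorm_average_sub_le {L : ℝ} {F : ℝ × ℝ → ℝ} (hFm : Measurable F)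
    (hF : MemLp F 2 (volOmega L)) {κ : ℝ≥0∞} (hκ : κ ≠ 0) :
    ∃ δ₀ : ℝ, 0 < δ₀ ∧ ∀ δ lam c η, δ ≤ δ₀ → IsMollifier L δ lam c η →
      eLpNorm (fun p => average L lam c η F p - F p) 2 (volOmega L) ≤ κ := by
  -- Budget: averaging F - h costs 2(κ/4) by the Schur bound, while averaging the continuous h and
  -- replacing F by h cost κ/4 each.
  have hκ4 : κ / 4 ≠ 0 := by simp [ENNReal.div_eq_zero_iff, hκ]
  obtain ⟨h, hc, hcont, hle⟩ := exists_continuous_eLpNorm_sub_le hF hκ4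
  obtain ⟨C, hC, hCb⟩ := exists_bound_eLpNorm_le L hκ4
  obtain ⟨δ₁, hδ₁, hu⟩ := Metric.uniformContinuous_iff.1
    (hc.uniformContinuous_of_continuous hcont) C hC
  refine ⟨δ₁ / 2, by positivity, fun δ lam c η hδ hη => ?_⟩
  have hηc := hη.isTestOn.contDiff.continuous
  have hFi : Integrable F (volOmega L) := hF.integrable (by norm_num)
  have hhi : Integrable h (volOmega L) := (hcont.integrable_of_hasCompactSupport hc).restrict
  have e : (fun p => average L lam c η F p - F p) =ᵐ[volOmega L]
      fun p => average L lam c η (fun q => F q - h q) p +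
        ((average L lam c η h p - h p) - (F p - h p)) := by
    filter_upwards [average_sub_ae (lam := lam) (c := c) hη.isTestOn hFi hhi] with p hp
    rw [hp]; ring
  have m1 : AEStronglyMeasurable (average L lam c η (fun q => F q - h q)) (volOmega L) :=
    (stronglyMeasurable_average hηc (hFm.sub hcont.measurable)).aestronglyMeasurable
  have m2 : AEStronglyMeasurable (fun p => average L lam c η h p - h p) (volOmega L) :=
    ((stronglyMeasurable_average hηc hcont.measurable).sub
      hcont.stronglyMeasurable).aestronglyMeasurable
  have m3 : AEStronglyMeasurable (fun p => F p - h p) (volOmega L) :=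
    (hFm.sub hcont.measurable).aestronglyMeasurable
  have b1 := hη.eLpNorm_average_le (F := fun q => F q - h q) (hFm.sub hcont.measurable)
  have b2 : eLpNorm (fun p => average L lam c η h p - h p) 2 (volOmega L) ≤ κ / 4 := by
    refine hCb _ ?_
    filter_upwards [ae_mem_omega L] with p hp
    have hx : p.1 ∈ Icc 0 L := Ioo_subset_Icc_self hp.1
    have i0 : Integrable (fun y => η (lam * p.1 + c - y)) (volIoo 0 L) :=
      (hη.integrable.comp_sub_left _).restrict
    have i1 : Integrable (fun y => η (lam * p.1 + c - y) * h (y, p.2)) (volIoo 0 L) := by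
      obtain ⟨D, hD⟩ := hcont.bounded_above_of_compact_support hc
      exact i0.mul_bdd (c := D)
        (hcont.comp (by fun_prop : Continuous fun y : ℝ => (y, p.2))).aestronglyMeasurable
        (Eventually.of_forall fun y => hD _)
    have e2 : average L lam c η h p - h p =
        ∫ y, η (lam * p.1 + c - y) * (h (y, p.2) - h p) ∂volIoo 0 L := by
      simp only [mul_sub]
      rw [integral_sub i1 (i0.mul_const _), integral_mul_const, hη.integral_slice hx, one_mul]
      rfl
    rw [e2]
    refine (abs_integral_le_integral_abs).trans ?_
    calc ∫ y, |η (lam * p.1 + c - y) * (h (y, p.2) - h p)| ∂volIoo 0 L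
        ≤ ∫ y, η (lam * p.1 + c - y) * C ∂volIoo 0 L := by
          refine integral_mono_of_nonneg (Eventually.of_forall fun y => abs_nonneg _)
            (i0.mul_const _) (Eventually.of_forall fun y => ?_)
          simp only [abs_mul, abs_of_nonneg (hη.nonneg _)]
          by_cases hz : η (lam * p.1 + c - y) = 0
          · simp [hz]
          · refine mul_le_mul_of_nonneg_left (hu (a := (y, p.2)) (b := p) ?_).le (hη.nonneg _)
            have := hη.near _ hx _ hz
            rw [Prod.dist_eq, dist_self, Real.dist_eq, abs_sub_comm]
            exact max_lt (by linarith) hδ₁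
      _ = C := by rw [integral_mul_const, hη.integral_slice hx, one_mul]
  rw [eLpNorm_congr_ae e]
  calc _ ≤ _ + (_ + _) := (eLpNorm_add_le m1 (m2.sub m3) (by norm_num)).trans
        (by gcongr; exact eLpNorm_sub_le m2 m3 (by norm_num))
    _ ≤ 2 * (κ / 4) + (κ / 4 + κ / 4) := by
        gcongr
        exact b1.trans (by gcongr)
    _ = κ := by
        rw [← two_mul, ← add_mul, show (2 + 2 : ℝ≥0∞) = 4 by norm_num,
          ENNReal.mul_div_cancel (by norm_num) (by norm_num)]

/-- Sums of products, polynomial in the second variable, are dense in `L²(ω)`. -/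
theorem exists_sum_mul_eLpNorm_sub_le {L : ℝ} {F : ℝ × ℝ → ℝ}
    (hF : MemLp F 2 (volOmega L)) {κ : ℝ≥0∞} (hκ : κ ≠ 0) :
    ∃ (N : ℕ) (α β : Fin N → ℝ → ℝ), (∀ i, Continuous (α i)) ∧
      (∀ i, ContDiff ℝ (⊤ : ℕ∞) (β i)) ∧
      eLpNorm (fun p => F p - ∑ i, α i p.1 * β i p.2) 2 (volOmega L) ≤ κ := by
  have hκ2 : κ / 2 ≠ 0 := by simp [ENNReal.div_eq_zero_iff, hκ]
  obtain ⟨h, hc, hcont, hle⟩ := exists_continuous_eLpNorm_sub_le hF hκ2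
  obtain ⟨C, hC, hCb⟩ := exists_bound_eLpNorm_le L hκ2
  rcases le_or_gt L 0 with hL | hL
  · refine ⟨0, fun _ _ => 0, fun _ _ => 0, by simp, by simp, ?_⟩
    have : volOmega L = 0 := by
      rw [volOmega_eq_prod, volIoo, Ioo_eq_empty (by linarith)]; simp
    simp [this]
  -- Bernstein approximation is applied to s ↦ h(·, s) with values in C([0, L]). Its terms are
  -- automatically products, the values at the nodes i/n times Bernstein polynomials in s.
  let H : C(unitInterval × Icc (0 : ℝ) L, ℝ) := ⟨fun q => h (q.2, q.1), by fun_prop⟩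
  obtain ⟨n, hn⟩ : ∃ n, ∀ s, dist (H.curry s) (bernsteinApproximation n H.curry s) < C :=
    (Metric.tendstoUniformly_iff.1 (ContinuousMap.tendsto_iff_tendstoUniformly.1
      (bernsteinApproximation_uniform H.curry)) C hC).exists
  refine ⟨n + 1, fun i y => h (y, (i : ℝ) / n),
    fun i s => (n.choose i : ℝ) * s ^ (i : ℕ) * (1 - s) ^ (n - i), ?_, ?_, ?_⟩
  · intro i; fun_prop
  · intro i; fun_prop
  · set G : ℝ × ℝ → ℝ := fun p => ∑ i : Fin (n + 1), h (p.1, (i : ℝ) / n) *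
      ((n.choose i : ℝ) * p.2 ^ (i : ℕ) * (1 - p.2) ^ (n - i)) with hG
    have hGc : Continuous G := by fun_prop
    have b2 : eLpNorm (fun p => h p - G p) 2 (volOmega L) ≤ κ / 2 := by
      refine hCb _ ?_
      filter_upwards [ae_mem_omega L] with p hp
      let y : Icc (0 : ℝ) L := ⟨p.1, Ioo_subset_Icc_self hp.1⟩
      let s : unitInterval := ⟨p.2, Ioo_subset_Icc_self hp.2⟩
      have h1 : dist (bernsteinApproximation n H.curry s y) (H.curry s y) ≤ C :=
        (ContinuousMap.dist_apply_le_dist y).trans ((dist_comm _ _).trans_le (hn s).le)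
      rw [bernsteinApproximation.apply] at h1
      rw [abs_sub_comm, ← Real.dist_eq]
      convert h1 using 2
      swap; · rfl
      simp only [hG, ContinuousMap.coe_sum, ContinuousMap.coe_smul, Finset.sum_apply,
        Pi.smul_apply, smul_eq_mul, bernstein_apply]
      exact Finset.sum_congr rfl fun i _ => mul_comm _ _
    have e : (fun p => F p - G p) = (fun p => F p - h p) + fun p => h p - G p := by
      ext p; simp
    change eLpNorm (fun p => F p - G p) 2 (volOmega L) ≤ κ
    rw [e]
    refine (eLpNorm_add_le (hF.1.sub hcont.aestronglyMeasurable)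
      (hcont.sub hGc).aestronglyMeasurable (by norm_num)).trans ?_
    calc _ ≤ κ / 2 + κ / 2 := add_le_add hle b2
      _ = κ := ENNReal.add_halves κ

/-! ### Regularity of primitives, vector calculus and the tangent frame -/

theorem five_le_infty : (5 : WithTop ℕ∞) ≤ ((⊤ : ℕ∞) : WithTop ℕ∞) :=
  WithTop.coe_le_coe.2 (le_top : (5 : ℕ∞) ≤ ⊤)

theorem continuous_prim {f : ℝ → ℝ} (hf : Continuous f) : Continuous (prim f) :=
  intervalIntegral.continuous_primitive (fun _ _ => hf.intervalIntegrable _ _) 0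

theorem hasDerivAt_prim {f : ℝ → ℝ} (hf : Continuous f) (s : ℝ) : HasDerivAt (prim f) (f s) s :=
  intervalIntegral.integral_hasDerivAt_right (hf.intervalIntegrable _ _)
    hf.stronglyMeasurable.stronglyMeasurableAtFilter hf.continuousAt

/-- The primitive even gains one derivative. Continuity of f on all of ℝ makes it two-sidedly
differentiable at 0 and 1 too. -/
theorem contDiffOn_prim {f : ℝ → ℝ} (hf : Continuous f) {n : ℕ}
    (h : ContDiffOn ℝ n f (Icc 0 1)) : ContDiffOn ℝ n (prim f) (Icc 0 1) := by
  refine ContDiffOn.of_le (n := (n : WithTop ℕ∞) + 1) ?_ le_self_add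
  rw [contDiffOn_succ_iff_derivWithin (uniqueDiffOn_Icc zero_lt_one)]
  refine ⟨fun s _ => (hasDerivAt_prim hf s).differentiableAt.differentiableWithinAt, by simp,
    h.congr fun s hs => ?_⟩
  exact (hasDerivAt_prim hf s).hasDerivWithinAt.derivWithin (uniqueDiffOn_Icc zero_lt_one s hs)

theorem hasDerivWithinAt_components {f : ℝ → E3} {d : E3} {t : Set ℝ} {x : ℝ} :
    HasDerivWithinAt f d t x ↔ ∀ i, HasDerivWithinAt (fun x => f x i) (d i) t x := by
  rw [hasDerivWithinAt_iff_hasFDerivWithinAt, hasFDerivWithinAt_euclidean]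
  refine forall_congr' fun i => ?_
  rw [hasDerivWithinAt_iff_hasFDerivWithinAt]
  refine iff_of_eq (congrArg (fun l => HasFDerivWithinAt (fun x => f x i) l t x) ?_)
  ext
  simp

theorem hasDerivAt_components {f : ℝ → E3} {d : E3} {x : ℝ} :
    HasDerivAt f d x ↔ ∀ i, HasDerivAt (fun x => f x i) (d i) x := by
  simp only [← hasDerivWithinAt_univ, hasDerivWithinAt_components]

theorem hasDerivAt_vec3 {f₀ f₁ f₂ : ℝ → ℝ} {d₀ d₁ d₂ x : ℝ} (h₀ : HasDerivAt f₀ d₀ x)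
    (h₁ : HasDerivAt f₁ d₁ x) (h₂ : HasDerivAt f₂ d₂ x) :
    HasDerivAt (fun x => (!₂[f₀ x, f₁ x, f₂ x] : E3)) !₂[d₀, d₁, d₂] x := by
  rw [hasDerivAt_components]
  intro i
  fin_cases i <;> assumption

theorem inner_vec3 (u : E3) (a b c : ℝ) :
    ⟪u, (!₂[a, b, c] : E3)⟫ = u 0 * a + u 1 * b + u 2 * c := by
  simp [PiLp.inner_apply, Fin.sum_univ_three, mul_comm]

/-- `T₂`, `T₃` are continuous on `ℝ` and coincide on `[0, 1]` with the components of the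
tangent vector. -/
structure IsTangent (γ : ℝ → E3) (T₂ T₃ : ℝ → ℝ) : Prop where
  continuous₂ : Continuous T₂
  continuous₃ : Continuous T₃
  contDiffOn₂ : ContDiffOn ℝ 5 T₂ (Icc 0 1)
  contDiffOn₃ : ContDiffOn ℝ 5 T₃ (Icc 0 1)
  sq_add_sq : ∀ s ∈ Icc (0 : ℝ) 1, T₂ s ^ 2 + T₃ s ^ 2 = 1
  tangentVec_eq : ∀ s ∈ Icc (0 : ℝ) 1, tangentVec γ s = !₂[0, T₂ s, T₃ s]

theorem IsTangent.normalVec_eq {γ : ℝ → E3} {T₂ T₃ : ℝ → ℝ} (h : IsTangent γ T₂ T₃) {s : ℝ}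
    (hs : s ∈ Icc (0 : ℝ) 1) : normalVec γ s = !₂[0, -T₃ s, T₂ s] := by
  simp [normalVec, h.tangentVec_eq s hs]

/-- The tangent is extended to ℝ by its endpoint values, which keeps it continuous; only on [0, 1]
is it C⁵. Its first component vanishes there because γ₁ does. -/
theorem IsPlanarArclengthCurve.exists_isTangent {γ : ℝ → E3} (h : IsPlanarArclengthCurve γ) :
    ∃ T₂ T₃, IsTangent γ T₂ T₃ := by
  have hu := uniqueDiffOn_Icc (zero_lt_one (α := ℝ))
  have hτ : ContDiffOn ℝ 5 (tangentVec γ) (Icc 0 1) := h.contDiffOn.derivWithin hu (by norm_num)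
  have hp : ∀ s ∈ Icc (0 : ℝ) 1, (projIcc (0 : ℝ) 1 zero_le_one s : ℝ) = s := fun s hs => by
    rw [projIcc_of_mem _ hs]
  have hτi : ∀ i, ContDiffOn ℝ 5 (fun s => tangentVec γ s i) (Icc 0 1) :=
    fun i => (contDiffOn_euclidean.1 hτ) i
  have hT : ∀ i, ContDiffOn ℝ 5 (fun s : ℝ => tangentVec γ (projIcc (0 : ℝ) 1 zero_le_one s : ℝ) i)
      (Icc 0 1) := fun i => (hτi i).congr fun s hs => by simp only [hp s hs]
  have hc : ∀ i, Continuous (fun s : ℝ => tangentVec γ (projIcc (0 : ℝ) 1 zero_le_one s : ℝ) i) :=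
    fun i => (hτi i).continuousOn.comp_continuous
      (continuous_subtype_val.comp continuous_projIcc) fun s => Subtype.prop _
  have h0 : ∀ s ∈ Icc (0 : ℝ) 1, tangentVec γ s 0 = 0 := by
    intro s hs
    have h1 : HasDerivWithinAt γ (tangentVec γ s) (Icc 0 1) s :=
      (h.contDiffOn.differentiableOn (by norm_num) s hs).hasDerivWithinAt
    have h2 := (hasDerivWithinAt_components.1 h1) 0
    have h3 : HasDerivWithinAt (fun s => γ s 0) 0 (Icc 0 1) s :=
      (hasDerivWithinAt_const s _ 0).congr (fun t ht => h.fst_eq_zero t ht) (h.fst_eq_zero s hs)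
    exact (hu s hs).eq_deriv _ h2 h3
  refine ⟨_, _, hc 1, hc 2, hT 1, hT 2, fun s hs => ?_, fun s hs => ?_⟩
  · have h1 := h.norm_deriv s hs
    rw [EuclideanSpace.norm_eq, Real.sqrt_eq_one, Fin.sum_univ_three] at h1
    have h2 := h0 s hs
    simp only [tangentVec] at h2
    simp only [h2, Real.norm_eq_abs, sq_abs] at h1
    simp only [hp s hs, tangentVec]
    linarith
  · ext i
    fin_cases i <;> simp [hp s hs, h0 s hs]

/-! ### Fields whose only strain is axial -/

/-- `(G, B)` is the pair (axial strain, bending) of a `C⁵` field which is otherwise unstrained. -/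
def Realizable (L : ℝ) (γ : ℝ → E3) (G B : ℝ × ℝ → ℝ) : Prop :=
  ∃ φ : ℝ × ℝ → E3, ContDiffOn ℝ 5 φ (Icc 0 L ×ˢ Icc 0 1) ∧
    ∀ p ∈ omega L, symGrad γ φ p = !![G p, 0; 0, 0] ∧
      HasDerivAt (fun s => ⟪pdS φ (p.1, s), normalVec γ s⟫) (B p) p.2

section Realizable

variable {L : ℝ} {γ : ℝ → E3} {G B G' B' : ℝ × ℝ → ℝ}

theorem differentiableAt_of_contDiffOn {φ : ℝ × ℝ → E3}
    (h : ContDiffOn ℝ 5 φ (Icc 0 L ×ˢ Icc 0 1)) {p : ℝ × ℝ} (hp : p ∈ omega L) :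
    DifferentiableAt ℝ φ p := by
  refine (h.contDiffAt (mem_of_superset ((omega L).isOpen.mem_nhds hp) ?_)).differentiableAt
    (by norm_num)
  exact prod_mono Ioo_subset_Icc_self Ioo_subset_Icc_self

theorem differentiableAt_slice {F : Type*} [NormedAddCommGroup F] [NormedSpace ℝ F]
    {φ : ℝ × ℝ → F} {p : ℝ × ℝ} (h : DifferentiableAt ℝ φ p) :
    DifferentiableAt ℝ (fun x => φ (x, p.2)) p.1 ∧ DifferentiableAt ℝ (fun s => φ (p.1, s)) p.2 :=
  ⟨DifferentiableAt.comp (g := φ) p.1 h (by fun_prop),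
    DifferentiableAt.comp (g := φ) p.2 h (by fun_prop)⟩

theorem pd1_add {F : Type*} [NormedAddCommGroup F] [NormedSpace ℝ F]
    {φ ψ : ℝ × ℝ → F} {p : ℝ × ℝ} (h : DifferentiableAt ℝ φ p) (h' : DifferentiableAt ℝ ψ p) :
    pd1 (fun q => φ q + ψ q) p = pd1 φ p + pd1 ψ p :=
  deriv_fun_add (differentiableAt_slice h).1 (differentiableAt_slice h').1

theorem pdS_add {F : Type*} [NormedAddCommGroup F] [NormedSpace ℝ F]
    {φ ψ : ℝ × ℝ → F} {p : ℝ × ℝ} (h : DifferentiableAt ℝ φ p) (h' : DifferentiableAt ℝ ψ p) :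
    pdS (fun q => φ q + ψ q) p = pdS φ p + pdS ψ p :=
  deriv_fun_add (differentiableAt_slice h).2 (differentiableAt_slice h').2

theorem symGrad_add {φ ψ : ℝ × ℝ → E3} {p : ℝ × ℝ} (h : DifferentiableAt ℝ φ p)
    (h' : DifferentiableAt ℝ ψ p) :
    symGrad γ (fun q => φ q + ψ q) p = symGrad γ φ p + symGrad γ ψ p := by
  have e := differentiableAt_euclidean.1 h 0
  have e' := differentiableAt_euclidean.1 h' 0
  simp only [symGrad, PiLp.add_apply, pd1_add h h', pdS_add h h', pd1_add e e', pdS_add e e',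
    inner_add_left]
  ext i j
  fin_cases i <;> fin_cases j <;> simp <;> ring

theorem Realizable.add (h : Realizable L γ G B) (h' : Realizable L γ G' B') :
    Realizable L γ (fun p => G p + G' p) (fun p => B p + B' p) := by
  obtain ⟨φ, hφ, h⟩ := h
  obtain ⟨ψ, hψ, h'⟩ := h'
  refine ⟨fun q => φ q + ψ q, hφ.add hψ, fun p hp => ⟨?_, ?_⟩⟩
  · rw [symGrad_add (differentiableAt_of_contDiffOn hφ hp) (differentiableAt_of_contDiffOn hψ hp),
      (h p hp).1, (h' p hp).1]
    ext i j
    fin_cases i <;> fin_cases j <;> simp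
  · refine ((h p hp).2.add (h' p hp).2).congr_of_eventuallyEq ?_
    filter_upwards [isOpen_Ioo.mem_nhds hp.2] with s hs
    have hq : (p.1, s) ∈ omega L := ⟨hp.1, hs⟩
    rw [pdS_add (differentiableAt_of_contDiffOn hφ hq) (differentiableAt_of_contDiffOn hψ hq),
      inner_add_left]
    rfl

/-- Fields with separated variables. -/
theorem realizable_mode {T₂ T₃ : ℝ → ℝ} (hT : IsTangent γ T₂ T₃) {a q₂ q₃ θ β : ℝ → ℝ}
    (ha : ContDiff ℝ (⊤ : ℕ∞) a) (c₂ : Continuous q₂) (c₃ : Continuous q₃)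
    (hq₂ : ContDiffOn ℝ 5 q₂ (Icc 0 1)) (hq₃ : ContDiffOn ℝ 5 q₃ (Icc 0 1))
    (d₂ : ∀ s, HasDerivAt q₂ (-T₃ s * θ s) s) (d₃ : ∀ s, HasDerivAt q₃ (T₂ s * θ s) s)
    (dθ : ∀ s, HasDerivAt θ (β s) s) :
    Realizable L γ (fun p => -(deriv (deriv a) p.1 * prim (fun s => T₂ s * q₂ s + T₃ s * q₃ s) p.2))
      (fun p => a p.1 * β p.2) := by
  set R := prim (fun s => T₂ s * q₂ s + T₃ s * q₃ s) with hR
  have hc : Continuous fun s => T₂ s * q₂ s + T₃ s * q₃ s :=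
    (hT.continuous₂.mul c₂).add (hT.continuous₃.mul c₃)
  have dR : ∀ s, HasDerivAt R (T₂ s * q₂ s + T₃ s * q₃ s) s := hasDerivAt_prim hc
  have hRc : ContDiffOn ℝ 5 R (Icc 0 1) := contDiffOn_prim (n := 5) hc
    ((hT.contDiffOn₂.mul hq₂).add (hT.contDiffOn₃.mul hq₃))
  have ha1 : ContDiff ℝ (⊤ : ℕ∞) (deriv a) := (contDiff_infty_iff_deriv.1 ha).2
  have da : ∀ x, HasDerivAt a (deriv a x) x := fun x =>
    ((contDiff_infty_iff_deriv.1 ha).1 x).hasDerivAt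
  have da1 : ∀ x, HasDerivAt (deriv a) (deriv (deriv a) x) x := fun x =>
    ((contDiff_infty_iff_deriv.1 ha1).1 x).hasDerivAt
  -- The first component is forced by the vanishing shear: ∂ₛφ₁ = -∂₁φ · τ = -a'(τ · q). The strain
  -- ∂ₛφ · τ vanishes because q' is normal.
  set φ : ℝ × ℝ → E3 := fun p => !₂[-(deriv a p.1 * R p.2), a p.1 * q₂ p.2, a p.1 * q₃ p.2]
  have dx : ∀ p : ℝ × ℝ, HasDerivAt (fun x => φ (x, p.2))
      !₂[-(deriv (deriv a) p.1 * R p.2), deriv a p.1 * q₂ p.2, deriv a p.1 * q₃ p.2] p.1 :=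
    fun p => hasDerivAt_vec3 ((da1 _).mul_const (R p.2)).neg ((da _).mul_const (q₂ p.2))
      ((da _).mul_const (q₃ p.2))
  have ds : ∀ p : ℝ × ℝ, HasDerivAt (fun s => φ (p.1, s))
      !₂[-(deriv a p.1 * (T₂ p.2 * q₂ p.2 + T₃ p.2 * q₃ p.2)), a p.1 * (-T₃ p.2 * θ p.2),
        a p.1 * (T₂ p.2 * θ p.2)] p.2 :=
    fun p => hasDerivAt_vec3 ((dR _).const_mul (deriv a p.1)).neg
      ((d₂ _).const_mul (a p.1)) ((d₃ _).const_mul (a p.1))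
  have e1 : ∀ p, pd1 φ p = _ := fun p => (dx p).deriv
  have es : ∀ p, pdS φ p = _ := fun p => (ds p).deriv
  have e1' : ∀ p, pd1 (fun q => φ q 0) p = -(deriv (deriv a) p.1 * R p.2) :=
    fun p => ((hasDerivAt_components.1 (dx p)) 0).deriv
  have es' : ∀ p, pdS (fun q => φ q 0) p = -(deriv a p.1 * (T₂ p.2 * q₂ p.2 + T₃ p.2 * q₃ p.2)) :=
    fun p => ((hasDerivAt_components.1 (ds p)) 0).deriv
  refine ⟨φ, ?_, fun p hp => ⟨?_, ?_⟩⟩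
  · have m1 : MapsTo Prod.fst (Icc 0 L ×ˢ Icc (0 : ℝ) 1) (Icc 0 L) := fun p hp => hp.1
    have m2 : MapsTo Prod.snd (Icc 0 L ×ˢ Icc (0 : ℝ) 1) (Icc 0 1) := fun p hp => hp.2
    have ca : ContDiffOn ℝ 5 (fun p : ℝ × ℝ => a p.1) (Icc 0 L ×ˢ Icc (0 : ℝ) 1) :=
      ((ha.of_le five_le_infty).comp contDiff_fst).contDiffOn
    have ca1 : ContDiffOn ℝ 5 (fun p : ℝ × ℝ => deriv a p.1) (Icc 0 L ×ˢ Icc (0 : ℝ) 1) :=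
      ((ha1.of_le five_le_infty).comp contDiff_fst).contDiffOn
    rw [contDiffOn_euclidean]
    intro i
    fin_cases i
    · exact (ca1.mul (hRc.comp contDiff_snd.contDiffOn m2)).neg
    · exact ca.mul (hq₂.comp contDiff_snd.contDiffOn m2)
    · exact ca.mul (hq₃.comp contDiff_snd.contDiffOn m2)
  · have hs := Ioo_subset_Icc_self hp.2
    simp only [symGrad, e1, es, e1', es', hT.tangentVec_eq _ hs, inner_vec3]
    ext i j
    fin_cases i <;> fin_cases j <;> simp <;> ring
  · refine ((dθ p.2).const_mul (a p.1)).congr_of_eventuallyEq ?_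
    filter_upwards [isOpen_Ioo.mem_nhds hp.2] with s hs
    have hs := Ioo_subset_Icc_self hs
    have := hT.sq_add_sq s hs
    simp only [es, hT.normalVec_eq hs, inner_vec3]
    simp
    -- Since q' = θ n and |n| = 1, the normal component of ∂ₛφ is aθ.
    linear_combination (a p.1 * θ s) * this

theorem realizable_axial {T₂ T₃ : ℝ → ℝ} (hT : IsTangent γ T₂ T₃) {m : ℝ → ℝ} (hm : ContDiff ℝ (⊤ : ℕ∞) m) :
    Realizable L γ (fun p => m p.1) (fun _ => 0) := by
  have hmc := hm.continuous
  have hM : ContDiff ℝ (⊤ : ℕ∞) (prim m) := by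
    rw [contDiff_infty_iff_deriv, funext fun s => (hasDerivAt_prim hmc s).deriv]
    exact ⟨fun s => (hasDerivAt_prim hmc s).differentiableAt, hm⟩
  set φ : ℝ × ℝ → E3 := fun p => !₂[prim m p.1, 0, 0]
  have dx : ∀ p : ℝ × ℝ, HasDerivAt (fun x => φ (x, p.2)) !₂[m p.1, 0, 0] p.1 :=
    fun p => hasDerivAt_vec3 (hasDerivAt_prim hmc _) (hasDerivAt_const _ _) (hasDerivAt_const _ _)
  have e1 : ∀ p, pd1 φ p = _ := fun p => (dx p).deriv
  have e1' : ∀ p, pd1 (fun q => φ q 0) p = m p.1 :=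
    fun p => ((hasDerivAt_components.1 (dx p)) 0).deriv
  have es : ∀ p, pdS φ p = 0 := fun p => deriv_const p.2 (φ (p.1, 0))
  have es' : ∀ p, pdS (fun q => φ q 0) p = 0 := fun p => deriv_const p.2 (prim m p.1)
  refine ⟨φ, ?_, fun p hp => ⟨?_, ?_⟩⟩
  · have cM : ContDiffOn ℝ 5 (fun p : ℝ × ℝ => prim m p.1) (Icc 0 L ×ˢ Icc (0 : ℝ) 1) :=
      ((hM.of_le five_le_infty).comp contDiff_fst).contDiffOn
    rw [contDiffOn_euclidean]
    intro i
    fin_cases i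
    · exact cM
    · exact contDiffOn_const
    · exact contDiffOn_const
  · simp only [symGrad, e1, es, e1', es', hT.tangentVec_eq _ (Ioo_subset_Icc_self hp.2), inner_vec3]
    ext i j
    fin_cases i <;> fin_cases j <;> simp
  · simp only [es, inner_zero_left]
    exact hasDerivAt_const _ _

end Realizable

/-! ### Linearity and bounds for primitives and warpings -/

section Prim

variable {f g : ℝ → ℝ} {s : ℝ}

theorem intervalIntegrable_zero_of_volIoo (hf : Integrable f (volIoo 0 1))
    (hs : s ∈ Icc (0 : ℝ) 1) : IntervalIntegrable f volume 0 s :=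
  (intervalIntegrable_of_volIoo hf).mono_set (by
    rw [uIcc_of_le hs.1, uIcc_of_le zero_le_one]; exact Icc_subset_Icc_right hs.2)

theorem prim_add (hf : Integrable f (volIoo 0 1)) (hg : Integrable g (volIoo 0 1))
    (hs : s ∈ Icc (0 : ℝ) 1) : prim (fun t => f t + g t) s = prim f s + prim g s :=
  intervalIntegral.integral_add (intervalIntegrable_zero_of_volIoo hf hs)
    (intervalIntegrable_zero_of_volIoo hg hs)

theorem prim_const_mul (a : ℝ) (f : ℝ → ℝ) (s : ℝ) : prim (fun t => a * f t) s = a * prim f s :=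
  intervalIntegral.integral_const_mul _ _

theorem prim_congr_ae (h : ∀ᵐ t ∂volIoo 0 1, f t = g t) (hs : s ∈ Icc (0 : ℝ) 1) :
    prim f s = prim g s := by
  rw [prim, prim, intervalIntegral.integral_of_le hs.1, intervalIntegral.integral_of_le hs.1,
    integral_Ioc_eq_integral_Ioo, integral_Ioc_eq_integral_Ioo]
  exact integral_congr_ae (ae_restrict_of_ae_restrict_of_subset (Ioo_subset_Ioo_right hs.2) h)

theorem integrable_prim (hf : Integrable f (volIoo 0 1)) : Integrable (prim f) (volIoo 0 1) := by
  have := (prim_ac hf).continuousOn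
  rw [uIcc_of_le zero_le_one] at this
  exact (this.integrableOn_Icc).mono_set Ioo_subset_Icc_self

theorem integrable_continuous_mul {T : ℝ → ℝ} (hT : Continuous T)
    (hf : Integrable f (volIoo 0 1)) : Integrable (fun t => T t * f t) (volIoo 0 1) := by
  obtain ⟨C, hC⟩ := isCompact_Icc.exists_bound_of_continuousOn (s := Icc (0 : ℝ) 1) hT.continuousOn
  refine hf.bdd_mul (c := C) hT.aestronglyMeasurable ?_
  filter_upwards [ae_restrict_mem measurableSet_Ioo] with s hs using hC s (Ioo_subset_Icc_self hs)

theorem integrable_volIoo_of_continuous (hf : Continuous f) : Integrable f (volIoo 0 1) :=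
  (hf.continuousOn.integrableOn_Icc (a := 0) (b := 1)).mono_set Ioo_subset_Icc_self

theorem abs_prim_le {M : ℝ} (h : ∀ t ∈ Icc (0 : ℝ) 1, |f t| ≤ M) (hs : s ∈ Icc (0 : ℝ) 1) :
    |prim f s| ≤ M := by
  have hM : 0 ≤ M := (abs_nonneg _).trans (h 0 (by simp))
  have := intervalIntegral.norm_integral_le_of_norm_le_const (f := f) (a := 0) (b := s) (C := M)
    fun t ht => h t (by
      rw [uIoc_of_le hs.1] at ht
      exact ⟨ht.1.le, ht.2.trans hs.2⟩)
  rw [sub_zero, abs_of_nonneg hs.1] at this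
  exact this.trans (mul_le_of_le_one_right hM hs.2)

theorem abs_prim_le_integral (hf : Integrable f (volIoo 0 1)) (hs : s ∈ Icc (0 : ℝ) 1) :
    |prim f s| ≤ ∫ t, |f t| ∂volIoo 0 1 := by
  rw [prim, intervalIntegral.integral_of_le hs.1, integral_Ioc_eq_integral_Ioo]
  exact abs_integral_le_integral_abs.trans (setIntegral_mono_set hf.abs
    (Eventually.of_forall fun _ => abs_nonneg _) (Ioo_subset_Ioo_right hs.2).eventuallyLE)

end Prim

/-- The double primitive `∫₀ˢ T · ∫₀ᵗ θ n` with `T = (T₂, T₃)` and `n = (-T₃, T₂)`: the warping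
generated by the rotation `θ`. -/
noncomputable def warping (T₂ T₃ θ : ℝ → ℝ) : ℝ → ℝ :=
  prim fun t => T₂ t * prim (fun r => -T₃ r * θ r) t + T₃ t * prim (fun r => T₂ r * θ r) t

theorem warping_add {T₂ T₃ : ℝ → ℝ} (h₂ : Continuous T₂) (h₃ : Continuous T₃) {θ θ' : ℝ → ℝ}
    {s : ℝ} (hθ : Integrable θ (volIoo 0 1)) (hθ' : Integrable θ' (volIoo 0 1))
    (hs : s ∈ Icc (0 : ℝ) 1) :
    warping T₂ T₃ (fun t => θ t + θ' t) s = warping T₂ T₃ θ s + warping T₂ T₃ θ' s := by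
  have a := integrable_continuous_mul (T := fun r => -T₃ r) h₃.neg hθ
  have a' := integrable_continuous_mul (T := fun r => -T₃ r) h₃.neg hθ'
  have b := integrable_continuous_mul h₂ hθ
  have b' := integrable_continuous_mul h₂ hθ'
  rw [warping, warping, warping, ← prim_add _ _ hs]
  · refine prim_congr_ae ?_ hs
    filter_upwards [ae_restrict_mem measurableSet_Ioo] with t ht
    have ht := Ioo_subset_Icc_self ht
    simp only [mul_add]
    rw [prim_add a a' ht, prim_add b b' ht]
    ring
  · exact (integrable_continuous_mul h₂ (integrable_prim a)).add
      (integrable_continuous_mul h₃ (integrable_prim b))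
  · exact (integrable_continuous_mul h₂ (integrable_prim a')).add
      (integrable_continuous_mul h₃ (integrable_prim b'))

theorem warping_const_mul {T₂ T₃ θ : ℝ → ℝ} (a s : ℝ) :
    warping T₂ T₃ (fun t => a * θ t) s = a * warping T₂ T₃ θ s := by
  rw [warping, warping, ← prim_const_mul]
  congr 1; ext t
  simp only [mul_left_comm _ a, prim_const_mul]
  ring

theorem warping_sum {T₂ T₃ : ℝ → ℝ} (h₂ : Continuous T₂) (h₃ : Continuous T₃) {ι : Type*}
    (S : Finset ι) (a : ι → ℝ) {θ : ι → ℝ → ℝ} (hθ : ∀ i, Integrable (θ i) (volIoo 0 1)) {s : ℝ}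
    (hs : s ∈ Icc (0 : ℝ) 1) :
    warping T₂ T₃ (fun t => ∑ i ∈ S, a i * θ i t) s = ∑ i ∈ S, a i * warping T₂ T₃ (θ i) s := by
  classical
  induction S using Finset.induction_on with
  | empty => simp [warping, prim]
  | insert i S hi ih =>
    simp only [Finset.sum_insert hi]
    rw [warping_add h₂ h₃ ((hθ i).const_mul _) (integrable_finsetSum _ fun j _ =>
      (hθ j).const_mul _) hs, warping_const_mul, ih]

theorem continuous_warping {T₂ T₃ θ : ℝ → ℝ} (h₂ : Continuous T₂) (h₃ : Continuous T₃)
    (hθ : Continuous θ) : Continuous (warping T₂ T₃ θ) :=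
  continuous_prim ((h₂.mul (continuous_prim (h₃.neg.mul hθ))).add
    (h₃.mul (continuous_prim (h₂.mul hθ))))

theorem abs_warping_le {T₂ T₃ θ : ℝ → ℝ} (h : ∀ s ∈ Icc (0 : ℝ) 1, T₂ s ^ 2 + T₃ s ^ 2 = 1)
    {M : ℝ} (hM : ∀ t ∈ Icc (0 : ℝ) 1, |θ t| ≤ M) {s : ℝ} (hs : s ∈ Icc (0 : ℝ) 1) :
    |warping T₂ T₃ θ s| ≤ 2 * M := by
  have h2 : ∀ t ∈ Icc (0 : ℝ) 1, |T₂ t| ≤ 1 := fun t ht =>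
    (abs_le_one_iff_mul_self_le_one).2 (by nlinarith [h t ht, sq_nonneg (T₃ t)])
  have h3 : ∀ t ∈ Icc (0 : ℝ) 1, |T₃ t| ≤ 1 := fun t ht =>
    (abs_le_one_iff_mul_self_le_one).2 (by nlinarith [h t ht, sq_nonneg (T₂ t)])
  have hmul {a x : ℝ} (ha : |a| ≤ 1) (hx : |x| ≤ M) : |a * x| ≤ M := by
    rw [abs_mul]
    exact (mul_le_of_le_one_left (abs_nonneg _) ha).trans hx
  refine abs_prim_le (fun t ht => (abs_add_le _ _).trans ?_) hs
  rw [two_mul]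
  exact add_le_add
    (hmul (h2 t ht) (abs_prim_le (fun r hr => hmul (by rw [abs_neg]; exact h3 r hr) (hM r hr)) ht))
    (hmul (h3 t ht) (abs_prim_le (fun r hr => hmul (h2 r hr) (hM r hr)) ht))

/-! ### Weak equations and the representation of the averaged strain -/

/-- The weak equations linking the strain `g`, the rotation `θ`, the bending `b` and the
displacement `(v₂, v₃)`. -/
structure IsWeakSolution (L : ℝ) (T₂ T₃ : ℝ → ℝ) (θ v₂ v₃ b g : ℝ × ℝ → ℝ) : Prop where
  integrable_rot : Integrable θ (volOmega L)
  integrable₂ : Integrable v₂ (volOmega L)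
  integrable₃ : Integrable v₃ (volOmega L)
  integrable_bend : Integrable b (volOmega L)
  integrable_strain : Integrable g (volOmega L)
  rot : ∀ ψ ζ, IsTestOn (Ioo 0 L) ψ → IsTestOn (Ioo 0 1) ζ →
    ∫ p, deriv ζ p.2 * (ψ p.1 * θ p) ∂volOmega L = -∫ p, ζ p.2 * (ψ p.1 * b p) ∂volOmega L
  disp₂ : ∀ ψ ζ, IsTestOn (Ioo 0 L) ψ → IsTestOn (Ioo 0 1) ζ →
    ∫ p, deriv ζ p.2 * (ψ p.1 * v₂ p) ∂volOmega L =
      -∫ p, ζ p.2 * (ψ p.1 * (-T₃ p.2 * θ p)) ∂volOmega L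
  disp₃ : ∀ ψ ζ, IsTestOn (Ioo 0 L) ψ → IsTestOn (Ioo 0 1) ζ →
    ∫ p, deriv ζ p.2 * (ψ p.1 * v₃ p) ∂volOmega L =
      -∫ p, ζ p.2 * (ψ p.1 * (T₂ p.2 * θ p)) ∂volOmega L
  strain : ∀ ψ ζ, IsTestOn (Ioo 0 L) ψ → IsTestOn (Ioo 0 1) ζ →
    ∫ p, deriv ζ p.2 * (ψ p.1 * g p) ∂volOmega L =
      -∫ p, ζ p.2 * (-(deriv (deriv ψ) p.1 * (T₂ p.2 * v₂ p + T₃ p.2 * v₃ p))) ∂volOmega L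

theorem integrable_test_mul {L : ℝ} {U : Set ℝ} {ψ : ℝ → ℝ} (hψ : IsTestOn U ψ) {F : ℝ × ℝ → ℝ}
    (hF : Integrable F (volOmega L)) : Integrable (fun p => ψ p.1 * F p) (volOmega L) := by
  obtain ⟨C, -, hC⟩ := hψ.exists_bound
  exact hF.bdd_mul (hψ.contDiff.continuous.comp continuous_fst).aestronglyMeasurable
    (Eventually.of_forall fun p => hC _)

theorem lineInt_mul_snd (L : ℝ) (ψ T : ℝ → ℝ) (F : ℝ × ℝ → ℝ) (s : ℝ) :
    lineInt L (fun p => ψ p.1 * (T p.2 * F p)) s = T s * lineInt L (fun p => ψ p.1 * F p) s := by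
  simp only [lineInt, mul_left_comm _ (T s), integral_const_mul]

section Formula

variable {L : ℝ} {T₂ T₃ : ℝ → ℝ} {θ v₂ v₃ b g : ℝ × ℝ → ℝ}

/-- The strain averaged against `ψ`, in terms of the bending averaged against its second
derivative. -/
theorem IsWeakSolution.strain_ae_eq (h : IsWeakSolution L T₂ T₃ θ v₂ v₃ b g)
    (h₂ : Continuous T₂) (h₃ : Continuous T₃) {ψ : ℝ → ℝ} (hψ : IsTestOn (Ioo 0 L) ψ) :
    ∀ᵐ s ∂volIoo 0 1, lineInt L (fun p => ψ p.1 * g p) s =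
      (∫ p, (ψ p.1 * g p - (1 - p.2) *
        -(deriv (deriv ψ) p.1 * (T₂ p.2 * v₂ p + T₃ p.2 * v₃ p))) ∂volOmega L) -
      ((∫ p, (deriv (deriv ψ) p.1 * v₂ p - (1 - p.2) *
          (deriv (deriv ψ) p.1 * (-T₃ p.2 * θ p))) ∂volOmega L) * prim T₂ s +
        (∫ p, (deriv (deriv ψ) p.1 * v₃ p - (1 - p.2) *
          (deriv (deriv ψ) p.1 * (T₂ p.2 * θ p))) ∂volOmega L) * prim T₃ s +
        (∫ p, (deriv (deriv ψ) p.1 * θ p - (1 - p.2) *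
          (deriv (deriv ψ) p.1 * b p)) ∂volOmega L) * warping T₂ T₃ (fun _ => 1) s +
        warping T₂ T₃ (prim (lineInt L fun p => deriv (deriv ψ) p.1 * b p)) s) := by
  set χ := deriv (deriv ψ) with hχdef
  have hχ : IsTestOn (Ioo 0 L) χ := hψ.deriv.deriv
  have i₂ : Integrable (fun p => T₂ p.2 * θ p) (volOmega L) := integrable_mul_snd h.integrable_rot h₂
  have i₃ : Integrable (fun p => -T₃ p.2 * θ p) (volOmega L) :=
    integrable_mul_snd (u := fun r => -T₃ r) h.integrable_rot h₃.neg
  have iv₂ : Integrable (fun p => T₂ p.2 * v₂ p) (volOmega L) := integrable_mul_snd h.integrable₂ h₂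
  have iv₃ : Integrable (fun p => T₃ p.2 * v₃ p) (volOmega L) := integrable_mul_snd h.integrable₃ h₃
  -- The chain is integrated in s: the rotation from the bending, the displacement from the
  -- rotation, the strain from the displacement. Only the strain is weighted by ψ; the other three
  -- carry χ = ψ''.
  have e1 := lineInt_ae_eq (integrable_test_mul hχ h.integrable_rot)
    (integrable_test_mul hχ h.integrable_bend) fun ζ hζ => h.rot χ ζ hχ hζ
  have e2 := lineInt_ae_eq (integrable_test_mul hχ h.integrable₂)
    (integrable_test_mul hχ i₃) fun ζ hζ => h.disp₂ χ ζ hχ hζ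
  have e3 := lineInt_ae_eq (integrable_test_mul hχ h.integrable₃)
    (integrable_test_mul hχ i₂) fun ζ hζ => h.disp₃ χ ζ hχ hζ
  have e4 := lineInt_ae_eq (integrable_test_mul hψ h.integrable_strain)
    (integrable_test_mul hχ (iv₂.add iv₃)).neg fun ζ hζ => h.strain ψ ζ hψ hζ
  simp only [Pi.neg_apply, Pi.add_apply] at e4
  set A := ∫ p, (χ p.1 * θ p - (1 - p.2) * (χ p.1 * b p)) ∂volOmega L
  set V₂ := ∫ p, (χ p.1 * v₂ p - (1 - p.2) * (χ p.1 * (-T₃ p.2 * θ p))) ∂volOmega L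
  set V₃ := ∫ p, (χ p.1 * v₃ p - (1 - p.2) * (χ p.1 * (T₂ p.2 * θ p))) ∂volOmega L
  set Θ := lineInt L fun p => χ p.1 * θ p
  set β := lineInt L fun p => χ p.1 * b p
  have hΘ : Integrable Θ (volIoo 0 1) := integrable_lineInt (integrable_test_mul hχ h.integrable_rot)
  have hβ : Integrable β (volIoo 0 1) :=
    integrable_lineInt (integrable_test_mul hχ h.integrable_bend)
  have e5 : ∀ᵐ s ∂volIoo 0 1, lineInt L (fun p => χ p.1 * (T₂ p.2 * v₂ p + T₃ p.2 * v₃ p)) s =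
      T₂ s * (V₂ + prim (fun r => -T₃ r * Θ r) s) + T₃ s * (V₃ + prim (fun r => T₂ r * Θ r) s) := by
    filter_upwards [e2, e3, ae_integrable_line (integrable_test_mul hχ iv₂),
      ae_integrable_line (integrable_test_mul hχ iv₃)] with s h1 h2 h3 h4
    have e : lineInt L (fun p => χ p.1 * (T₂ p.2 * v₂ p + T₃ p.2 * v₃ p)) s =
        lineInt L (fun p => χ p.1 * (T₂ p.2 * v₂ p)) s +
        lineInt L (fun p => χ p.1 * (T₃ p.2 * v₃ p)) s := by
      simp only [lineInt, mul_add]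
      exact integral_add h3 h4
    rw [e, lineInt_mul_snd, lineInt_mul_snd, h1, h2]
    congr 3
    · congr 2; ext r
      exact lineInt_mul_snd L χ (fun r => -T₃ r) θ r
    · congr 2; ext r
      exact lineInt_mul_snd L χ T₂ θ r
  filter_upwards [e4, ae_restrict_mem measurableSet_Ioo] with s hs hs1
  have hs1 := Ioo_subset_Icc_self hs1
  rw [hs, sub_eq_add_neg]
  congr 1
  have j2 := integrable_continuous_mul h₂ hΘ
  have j3 := integrable_continuous_mul (T := fun r => -T₃ r) h₃.neg hΘ
  have k2 := integrable_volIoo_of_continuous h₂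
  have k3 := integrable_volIoo_of_continuous h₃
  have e6 : prim (lineInt L fun p => -(χ p.1 * (T₂ p.2 * v₂ p + T₃ p.2 * v₃ p))) s =
      -prim (fun t => V₂ * T₂ t + (V₃ * T₃ t + (T₂ t * prim (fun r => -T₃ r * Θ r) t +
        T₃ t * prim (fun r => T₂ r * Θ r) t))) s := by
    rw [prim, prim, ← intervalIntegral.integral_neg]
    refine prim_congr_ae ?_ hs1
    filter_upwards [e5] with t ht
    have : lineInt L (fun p => -(χ p.1 * (T₂ p.2 * v₂ p + T₃ p.2 * v₃ p))) t =
      -lineInt L (fun p => χ p.1 * (T₂ p.2 * v₂ p + T₃ p.2 * v₃ p)) t := integral_neg _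
    rw [this, ht]
    ring
  refine Eq.trans e6 ?_
  have l1 : Integrable (fun t => T₂ t * prim (fun r => -T₃ r * Θ r) t +
      T₃ t * prim (fun r => T₂ r * Θ r) t) (volIoo 0 1) :=
    (integrable_continuous_mul h₂ (integrable_prim j3)).add
      (integrable_continuous_mul h₃ (integrable_prim j2))
  have l2 : Integrable (fun t => V₃ * T₃ t + (T₂ t * prim (fun r => -T₃ r * Θ r) t +
      T₃ t * prim (fun r => T₂ r * Θ r) t)) (volIoo 0 1) := (k3.const_mul V₃).add l1
  rw [prim_add (k2.const_mul V₂) l2 hs1, prim_const_mul,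
    prim_add (k3.const_mul V₃) l1 hs1, prim_const_mul]
  -- The averaged rotation is A plus a primitive of the averaged bending, so its warping splits into
  -- A times the warping of 1 and a bending part.
  have e7 : prim (fun t => T₂ t * prim (fun r => -T₃ r * Θ r) t +
      T₃ t * prim (fun r => T₂ r * Θ r) t) s = warping T₂ T₃ (fun t => A * 1 + prim β t) s := by
    refine prim_congr_ae ?_ hs1
    filter_upwards [ae_restrict_mem measurableSet_Ioo] with t ht
    have ht := Ioo_subset_Icc_self ht
    congr 2 <;>
    · refine prim_congr_ae ?_ ht
      filter_upwards [e1] with r hr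
      rw [hr, mul_one]
  rw [e7, warping_add h₂ h₃ (integrable_const _) (integrable_prim hβ) hs1, warping_const_mul]
  ring

end Formula

/-! ### Smooth coefficients and the mollified representation formula -/

/-- Averages of `F` over `ω`, with weight `k (lam * x + c - ·)` in the first variable. -/
noncomputable def smear (L lam c : ℝ) (k : ℝ → ℝ) (F : ℝ × ℝ → ℝ) (x : ℝ) : ℝ :=
  ∫ p, k (lam * x + c - p.1) * F p ∂volOmega L

section Smear

variable {L lam c : ℝ} {k : ℝ → ℝ} {F : ℝ × ℝ → ℝ} {U : Set ℝ}

theorem contDiff_smear (hk : IsTestOn U k) (hF : Integrable F (volOmega L)) :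
    ContDiff ℝ (⊤ : ℕ∞) (smear L lam c k F) :=
  contDiff_kernel_integral hF measurable_fst.aestronglyMeasurable hk lam c

theorem deriv_deriv_of_hasDerivAt {f f' f'' : ℝ → ℝ} {a : ℝ}
    (h : ∀ x, HasDerivAt f (a * f' x) x) (h' : ∀ x, HasDerivAt f' (a * f'' x) x) :
    deriv (deriv f) = fun x => a ^ 2 * f'' x := by
  rw [funext fun x => (h x).deriv]
  ext x
  rw [((h' x).const_mul a).deriv]
  ring

/-- Each derivative in x brings out a factor lam from the contracted argument. -/
theorem deriv_deriv_smear (hk : IsTestOn U k) (hF : Integrable F (volOmega L)) :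
    deriv (deriv (smear L lam c k F)) = fun x => lam ^ 2 * smear L lam c (deriv (deriv k)) F x :=
  deriv_deriv_of_hasDerivAt
    (fun x => hasDerivAt_kernel_integral hF measurable_fst.aestronglyMeasurable hk lam c x)
    (fun x => hasDerivAt_kernel_integral hF measurable_fst.aestronglyMeasurable hk.deriv lam c x)

end Smear

theorem integrable_volOmega_of_continuous {L : ℝ} {f : ℝ × ℝ → ℝ} (hf : Continuous f) :
    Integrable f (volOmega L) :=
  (hf.continuousOn.integrableOn_compact (isCompact_Icc.prod isCompact_Icc)).mono_set
    (prod_mono Ioo_subset_Icc_self Ioo_subset_Icc_self)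

section Approximation

variable {L δ lam c : ℝ} {η T₂ T₃ : ℝ → ℝ} {θ v₂ v₃ b g : ℝ × ℝ → ℝ}

theorem deriv_deriv_slice (η : ℝ → ℝ) (z : ℝ) :
    deriv (deriv fun y => η (z - y)) = fun y => deriv (deriv η) (z - y) := by
  have h : ∀ f : ℝ → ℝ, deriv (fun y => f (z - y)) = fun y => -deriv f (z - y) :=
    fun f => funext fun y => deriv_comp_const_sub f z y
  rw [h]
  ext y
  rw [deriv.fun_neg, h, neg_neg]

/-- The part of the strain determined by the integration constants. -/
noncomputable def constantStrain (L lam c : ℝ) (η T₂ T₃ : ℝ → ℝ) (θ v₂ v₃ b g : ℝ × ℝ → ℝ)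
    (p : ℝ × ℝ) : ℝ :=
  (smear L lam c η g p.1 +
      smear L lam c (deriv (deriv η)) (fun q => (1 - q.2) * (T₂ q.2 * v₂ q + T₃ q.2 * v₃ q)) p.1) -
    (smear L lam c (deriv (deriv η)) (fun q => v₂ q - (1 - q.2) * (-T₃ q.2 * θ q)) p.1 *
        prim T₂ p.2 +
      smear L lam c (deriv (deriv η)) (fun q => v₃ q - (1 - q.2) * (T₂ q.2 * θ q)) p.1 *
        prim T₃ p.2 +
      smear L lam c (deriv (deriv η)) (fun q => θ q - (1 - q.2) * b q) p.1 *
        warping T₂ T₃ (fun _ => 1) p.2)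

/-- The representation formula with ψ = η(lam x + c - ·). Two sign changes cancel in ψ'', and the
integration constants become the smooth functions `smear` of x. -/
theorem IsWeakSolution.average_ae_eq (h : IsWeakSolution L T₂ T₃ θ v₂ v₃ b g)
    (h₂ : Continuous T₂) (h₃ : Continuous T₃) (hη : IsMollifier L δ lam c η) {x : ℝ}
    (hx : x ∈ Icc 0 L) :
    ∀ᵐ s ∂volIoo 0 1, average L lam c η g (x, s) =
      constantStrain L lam c η T₂ T₃ θ v₂ v₃ b g (x, s) -
      warping T₂ T₃ (prim fun t => average L lam c (deriv (deriv η)) b (x, t)) s := by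
  have hψ := hη.isTestOn_slice hx
  have iv : Integrable (fun q => (1 - q.2) * (T₂ q.2 * v₂ q + T₃ q.2 * v₃ q)) (volOmega L) :=
    integrable_mul_snd (u := fun s => 1 - s)
      ((integrable_mul_snd h.integrable₂ h₂).add (integrable_mul_snd h.integrable₃ h₃))
      (by fun_prop)
  have j1 := integrable_kernel_mul h.integrable_strain measurable_fst.aestronglyMeasurable
    hη.isTestOn (lam * x + c)
  have j2 := integrable_kernel_mul iv measurable_fst.aestronglyMeasurable
    hη.isTestOn.deriv.deriv (lam * x + c)
  filter_upwards [h.strain_ae_eq h₂ h₃ hψ] with s hs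
  rw [deriv_deriv_slice] at hs
  have e0 : smear L lam c η g x + smear L lam c (deriv (deriv η))
      (fun q => (1 - q.2) * (T₂ q.2 * v₂ q + T₃ q.2 * v₃ q)) x =
      ∫ p, (η (lam * x + c - p.1) * g p - (1 - p.2) * -(deriv (deriv η) (lam * x + c - p.1) *
        (T₂ p.2 * v₂ p + T₃ p.2 * v₃ p))) ∂volOmega L := by
    rw [smear, smear, ← integral_add j1 j2]
    congr 1; ext p; ring
  have e : ∀ F H : ℝ × ℝ → ℝ, ∫ p, (deriv (deriv η) (lam * x + c - p.1) * F p - (1 - p.2) *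
      (deriv (deriv η) (lam * x + c - p.1) * H p)) ∂volOmega L =
      smear L lam c (deriv (deriv η)) (fun q => F q - (1 - q.2) * H q) x := by
    intro F H
    rw [smear]
    congr 1; ext p; ring
  rw [e, e, e, ← e0] at hs
  rw [average, hs, constantStrain]
  have e3 : (fun t => average L lam c (deriv (deriv η)) b (x, t)) =
      lineInt L fun p => deriv (deriv η) (lam * x + c - p.1) * b p := rfl
  rw [e3]
  ring

/-- Replacing the bending by a nearby sum of products changes the averaged strain by little. -/
theorem IsWeakSolution.average_sub_le (h : IsWeakSolution L T₂ T₃ θ v₂ v₃ b g)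
    (h₂ : Continuous T₂) (h₃ : Continuous T₃)
    (hT : ∀ s ∈ Icc (0 : ℝ) 1, T₂ s ^ 2 + T₃ s ^ 2 = 1) (hη : IsMollifier L δ lam c η)
    {M : ℝ} (hM : ∀ x, |deriv (deriv η) x| ≤ M) {N : ℕ} {α β : Fin N → ℝ → ℝ}
    (hα : ∀ i, Continuous (α i)) (hβ : ∀ i, Continuous (β i)) {x : ℝ} (hx : x ∈ Icc 0 L) :
    ∀ᵐ s ∂volIoo 0 1,
      |(constantStrain L lam c η T₂ T₃ θ v₂ v₃ b g (x, s) -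
        ∑ i, (∫ y, deriv (deriv η) (lam * x + c - y) * α i y ∂volIoo 0 L) *
          warping T₂ T₃ (prim (β i)) s) - average L lam c η g (x, s)| ≤
      2 * (M * ∫ p, |b p - ∑ i, α i p.1 * β i p.2| ∂volOmega L) := by
  set χ := deriv (deriv η) with hχ
  have hχt : IsTestOn univ χ := hη.isTestOn.deriv.deriv
  set C : ℝ × ℝ → ℝ := fun p => ∑ i, α i p.1 * β i p.2 with hC
  have hCc : Continuous C := by fun_prop
  have hCi : Integrable C (volOmega L) := integrable_volOmega_of_continuous hCc
  set A : Fin N → ℝ := fun i => ∫ y, χ (lam * x + c - y) * α i y ∂volIoo 0 L with hA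
  have hαi : ∀ i, Integrable (fun y => χ (lam * x + c - y) * α i y) (volIoo 0 L) := fun i => by
    have : Continuous fun y => χ (lam * x + c - y) * α i y := by
      have := hχt.contDiff.continuous
      have := hα i
      fun_prop
    exact (this.continuousOn.integrableOn_Icc (a := 0) (b := L)).mono_set Ioo_subset_Icc_self
  have eC : ∀ t, average L lam c χ C (x, t) = ∑ i, A i * β i t := by
    intro t
    simp only [average, lineInt, hC, Finset.mul_sum, hA, ← integral_mul_const]
    rw [integral_finsetSum _ fun i _ => ?_]
    · simp only [mul_assoc]
    · simpa only [mul_assoc] using (hαi i).mul_const (β i t)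
  have hkb : Integrable (fun p => χ (lam * x + c - p.1) * b p) (volOmega L) :=
    integrable_kernel_mul h.integrable_bend measurable_fst.aestronglyMeasurable hχt _
  have hkd : Integrable (fun p => χ (lam * x + c - p.1) * (b p - C p)) (volOmega L) :=
    integrable_kernel_mul (h.integrable_bend.sub hCi) measurable_fst.aestronglyMeasurable hχt _
  have hb : Integrable (fun t => average L lam c χ b (x, t)) (volIoo 0 1) :=
    integrable_lineInt hkb
  have hd : Integrable (fun t => average L lam c χ (fun q => b q - C q) (x, t)) (volIoo 0 1) :=
    integrable_lineInt hkd
  have hprim : ∀ s ∈ Icc (0 : ℝ) 1, prim (fun t => average L lam c χ b (x, t)) s =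
      prim (fun t => average L lam c χ (fun q => b q - C q) (x, t)) s +
        ∑ i, A i * prim (β i) s := by
    intro s hs
    have e1 : prim (fun t => ∑ i, A i * β i t) s = ∑ i, A i * prim (β i) s := by
      simp only [prim]
      rw [intervalIntegral.integral_finsetSum fun i _ =>
        ((hβ i).intervalIntegrable _ _).const_mul _]
      simp only [intervalIntegral.integral_const_mul]
    rw [← e1, ← prim_add hd (integrable_volIoo_of_continuous (by fun_prop)) hs]
    refine prim_congr_ae ?_ hs
    filter_upwards [ae_integrable_line h.integrable_bend, ae_integrable_line hCi] with t h1 h2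
    rw [← eC t]
    simp only [average, lineInt, mul_sub]
    rw [integral_sub
      (integrable_kernel_mul (u := fun y => y) h1 measurable_id.aestronglyMeasurable hχt _)
      (integrable_kernel_mul (u := fun y => y) h2 measurable_id.aestronglyMeasurable hχt _)]
    ring
  have hM0 : 0 ≤ M := (abs_nonneg _).trans (hM 0)
  filter_upwards [h.average_ae_eq h₂ h₃ hη hx, ae_restrict_mem measurableSet_Ioo] with s hs hs1
  have hs1 := Ioo_subset_Icc_self hs1
  have e2 : warping T₂ T₃ (prim fun t => average L lam c χ b (x, t)) s =
      warping T₂ T₃ (prim fun t => average L lam c χ (fun q => b q - C q) (x, t)) s +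
        ∑ i, A i * warping T₂ T₃ (prim (β i)) s := by
    rw [← warping_sum h₂ h₃ Finset.univ A (θ := fun i => prim (β i))
      (fun i => integrable_volIoo_of_continuous (continuous_prim (hβ i))) hs1,
      ← warping_add h₂ h₃ (integrable_prim hd) (integrable_finsetSum _ fun i _ =>
        (integrable_volIoo_of_continuous (continuous_prim (hβ i))).const_mul _) hs1]
    refine prim_congr_ae ?_ hs1
    filter_upwards [ae_restrict_mem measurableSet_Ioo] with t ht
    have ht := Ioo_subset_Icc_self ht
    congr 2 <;>
    · refine prim_congr_ae ?_ ht
      filter_upwards [ae_restrict_mem measurableSet_Ioo] with r hr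
      rw [hprim r (Ioo_subset_Icc_self hr)]
  -- The constants cancel exactly; only the warping generated by b - C remains.
  have e3 : (constantStrain L lam c η T₂ T₃ θ v₂ v₃ b g (x, s) -
        ∑ i, A i * warping T₂ T₃ (prim (β i)) s) - average L lam c η g (x, s) =
      warping T₂ T₃ (prim fun t => average L lam c χ (fun q => b q - C q) (x, t)) s := by
    rw [hs, e2]; ring
  rw [e3]
  refine abs_warping_le hT (fun t ht => (abs_prim_le_integral hd ht).trans ?_) hs1
  have hkabs : Integrable (fun p => |χ (lam * x + c - p.1) * (b p - C p)|) (volOmega L) := hkd.abs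
  calc ∫ t, |average L lam c χ (fun q => b q - C q) (x, t)| ∂volIoo 0 1
      ≤ ∫ t, lineInt L (fun p => |χ (lam * x + c - p.1) * (b p - C p)|) t ∂volIoo 0 1 :=
        integral_mono hd.abs (integrable_lineInt hkabs) fun t => abs_integral_le_integral_abs
    _ = ∫ p, |χ (lam * x + c - p.1) * (b p - C p)| ∂volOmega L := by
        simpa using integral_mul_lineInt (ζ := fun _ => 1) (by simpa using hkabs)
    _ ≤ ∫ p, M * |b p - C p| ∂volOmega L := by
        refine integral_mono hkabs ((h.integrable_bend.sub hCi).abs.const_mul M) fun p => ?_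
        simp only [abs_mul]
        exact mul_le_mul_of_nonneg_right (hM _) (abs_nonneg _)
    _ = M * ∫ p, |b p - C p| ∂volOmega L := integral_const_mul _ _

end Approximation

/-! ### Elementary modes: rotations and translations -/

section Realizable

variable {L : ℝ} {γ : ℝ → E3} {T₂ T₃ : ℝ → ℝ}

theorem realizable_sum (hT : IsTangent γ T₂ T₃) {ι : Type*} (S : Finset ι)
    {G B : ι → ℝ × ℝ → ℝ} (h : ∀ i, Realizable L γ (G i) (B i)) :
    Realizable L γ (fun p => ∑ i ∈ S, G i p) (fun p => ∑ i ∈ S, B i p) := by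
  classical
  induction S using Finset.induction_on with
  | empty => simpa using realizable_axial (L := L) hT (m := fun _ => 0) contDiff_const
  | insert i S hi ih => simpa only [Finset.sum_insert hi] using (h i).add ih

theorem realizable_rotation (hT : IsTangent γ T₂ T₃) {a θ : ℝ → ℝ} (ha : ContDiff ℝ (⊤ : ℕ∞) a)
    (hθ : ContDiff ℝ (⊤ : ℕ∞) θ) :
    Realizable L γ (fun p => -(deriv (deriv a) p.1 * warping T₂ T₃ θ p.2))
      (fun p => a p.1 * deriv θ p.2) := by
  have hc := hθ.continuous
  have h5 : ContDiffOn ℝ 5 θ (Icc 0 1) := (hθ.of_le five_le_infty).contDiffOn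
  have c₂ : Continuous fun r => -T₃ r * θ r := hT.continuous₃.neg.mul hc
  have c₃ : Continuous fun r => T₂ r * θ r := hT.continuous₂.mul hc
  exact realizable_mode hT ha (continuous_prim c₂) (continuous_prim c₃)
    (contDiffOn_prim (n := 5) c₂ (hT.contDiffOn₃.neg.mul h5))
    (contDiffOn_prim (n := 5) c₃ (hT.contDiffOn₂.mul h5))
    (hasDerivAt_prim c₂) (hasDerivAt_prim c₃)
    fun s => ((contDiff_infty_iff_deriv.1 hθ).1 s).hasDerivAt

theorem realizable_translation₂ (hT : IsTangent γ T₂ T₃) {a : ℝ → ℝ}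
    (ha : ContDiff ℝ (⊤ : ℕ∞) a) :
    Realizable L γ (fun p => -(deriv (deriv a) p.1 * prim T₂ p.2)) (fun _ => 0) := by
  simpa using realizable_mode (L := L) hT ha (q₂ := fun _ => 1) (q₃ := fun _ => 0)
    (θ := fun _ => 0) (β := fun _ => 0) continuous_const continuous_const contDiffOn_const
    contDiffOn_const (fun s => by simpa using hasDerivAt_const s (1 : ℝ))
    (fun s => by simpa using hasDerivAt_const s (0 : ℝ)) (fun s => hasDerivAt_const s 0)

theorem realizable_translation₃ (hT : IsTangent γ T₂ T₃) {a : ℝ → ℝ}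
    (ha : ContDiff ℝ (⊤ : ℕ∞) a) :
    Realizable L γ (fun p => -(deriv (deriv a) p.1 * prim T₃ p.2)) (fun _ => 0) := by
  simpa using realizable_mode (L := L) hT ha (q₂ := fun _ => 0) (q₃ := fun _ => 1)
    (θ := fun _ => 0) (β := fun _ => 0) continuous_const continuous_const contDiffOn_const
    contDiffOn_const (fun s => by simpa using hasDerivAt_const s (0 : ℝ))
    (fun s => by simpa using hasDerivAt_const s (1 : ℝ)) (fun s => hasDerivAt_const s 0)

end Realizable

/-! ### Realization of the mollified strain -/

section Approximation

variable {L δ lam c : ℝ} {γ : ℝ → E3} {η T₂ T₃ : ℝ → ℝ} {θ v₂ v₃ b g : ℝ × ℝ → ℝ}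

theorem contDiff_infty_prim {f : ℝ → ℝ} (hf : ContDiff ℝ (⊤ : ℕ∞) f) :
    ContDiff ℝ (⊤ : ℕ∞) (prim f) := by
  rw [contDiff_infty_iff_deriv, funext fun s => (hasDerivAt_prim hf.continuous s).deriv]
  exact ⟨fun s => (hasDerivAt_prim hf.continuous s).differentiableAt, hf⟩

theorem IsWeakSolution.integrables (h : IsWeakSolution L T₂ T₃ θ v₂ v₃ b g)
    (h₂ : Continuous T₂) (h₃ : Continuous T₃) :
    Integrable (fun q => (1 - q.2) * (T₂ q.2 * v₂ q + T₃ q.2 * v₃ q)) (volOmega L) ∧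
    Integrable (fun q => v₂ q - (1 - q.2) * (-T₃ q.2 * θ q)) (volOmega L) ∧
    Integrable (fun q => v₃ q - (1 - q.2) * (T₂ q.2 * θ q)) (volOmega L) ∧
    Integrable (fun q => θ q - (1 - q.2) * b q) (volOmega L) := by
  have hc : Continuous fun s : ℝ => 1 - s := by fun_prop
  refine ⟨integrable_mul_snd (u := fun s => 1 - s) ?_ hc, h.integrable₂.sub
    (integrable_mul_snd (u := fun s => 1 - s) (integrable_mul_snd (u := fun s => -T₃ s)
      h.integrable_rot h₃.neg) hc), h.integrable₃.sub
    (integrable_mul_snd (u := fun s => 1 - s) (integrable_mul_snd h.integrable_rot h₂) hc),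
    h.integrable_rot.sub (integrable_mul_snd h.integrable_bend hc)⟩
  exact (integrable_mul_snd h.integrable₂ h₂).add (integrable_mul_snd h.integrable₃ h₃)

theorem continuous_constantStrain (h : IsWeakSolution L T₂ T₃ θ v₂ v₃ b g)
    (h₂ : Continuous T₂) (h₃ : Continuous T₃) (hη : IsTestOn univ η) :
    Continuous (constantStrain L lam c η T₂ T₃ θ v₂ v₃ b g) := by
  obtain ⟨i0, i1, i2, i3⟩ := h.integrables h₂ h₃
  have hη2 := hη.deriv.deriv
  have a := (contDiff_smear (lam := lam) (c := c) hη h.integrable_strain).continuous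
  have a0 := (contDiff_smear (lam := lam) (c := c) hη2 i0).continuous
  have a1 := (contDiff_smear (lam := lam) (c := c) hη2 i1).continuous
  have a2 := (contDiff_smear (lam := lam) (c := c) hη2 i2).continuous
  have a3 := (contDiff_smear (lam := lam) (c := c) hη2 i3).continuous
  have w := continuous_warping h₂ h₃ (continuous_const (y := (1 : ℝ)))
  have w2 := continuous_prim h₂
  have w3 := continuous_prim h₃
  unfold constantStrain
  fun_prop

/-- The field is assembled term by term from an axial displacement, two translations, a rigid
rotation and one rotation `prim (β i)` per product. Amplitudes lam⁻² times η-averages have as second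
derivatives exactly the η''-averages of the formula. Translations and the rigid rotation do not
bend, so the bending comes from the products alone. -/
theorem IsWeakSolution.realizable (h : IsWeakSolution L T₂ T₃ θ v₂ v₃ b g)
    (hT : IsTangent γ T₂ T₃) (hη : IsTestOn univ η) (hlam : lam ≠ 0) {N : ℕ}
    {α β : Fin N → ℝ → ℝ} (hα : ∀ i, Continuous (α i)) (hβ : ∀ i, ContDiff ℝ (⊤ : ℕ∞) (β i)) :
    Realizable L γ
      (fun p => constantStrain L lam c η T₂ T₃ θ v₂ v₃ b g p -
        ∑ i, (∫ y, deriv (deriv η) (lam * p.1 + c - y) * α i y ∂volIoo 0 L) *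
          warping T₂ T₃ (prim (β i)) p.2)
      (fun p => (lam ^ 2)⁻¹ * average L lam c η (fun q => ∑ i, α i q.1 * β i q.2) p) := by
  obtain ⟨i0, i1, i2, i3⟩ := h.integrables hT.continuous₂ hT.continuous₃
  have hη2 := hη.deriv.deriv
  have hl : lam ^ 2 ≠ 0 := pow_ne_zero 2 hlam
  have hαi : ∀ i, Integrable (α i) (volIoo 0 L) := fun i =>
    ((hα i).continuousOn.integrableOn_Icc (a := 0) (b := L)).mono_set Ioo_subset_Icc_self
  have hu : AEStronglyMeasurable (fun y : ℝ => y) (volIoo 0 L) := measurable_id.aestronglyMeasurable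
  -- The factor lam⁻² absorbs the lam² produced by the contraction.
  have dd : ∀ {f f'' : ℝ → ℝ}, ContDiff ℝ (⊤ : ℕ∞) f →
      (deriv (deriv f) = fun x => lam ^ 2 * f'' x) →
      deriv (deriv fun x => (lam ^ 2)⁻¹ * f x) = f'' := by
    intro f f'' hf hf''
    have h1 : deriv (fun x => (lam ^ 2)⁻¹ * f x) = fun x => (lam ^ 2)⁻¹ * deriv f x :=
      funext fun x => deriv_const_mul _ ((contDiff_infty_iff_deriv.1 hf).1 x)
    rw [h1]
    ext x
    rw [deriv_const_mul _ ((contDiff_infty_iff_deriv.1 (contDiff_infty_iff_deriv.1 hf).2).1 x),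
      hf'', inv_mul_cancel_left₀ hl]
  have r0 := realizable_axial (L := L) hT ((contDiff_smear (lam := lam) (c := c) hη
    h.integrable_strain).add (contDiff_smear (lam := lam) (c := c) hη2 i0))
  have s1 := contDiff_smear (lam := lam) (c := c) hη i1
  have s2 := contDiff_smear (lam := lam) (c := c) hη i2
  have s3 := contDiff_smear (lam := lam) (c := c) hη i3
  have r1 := realizable_translation₂ (L := L) hT (contDiff_const.mul s1 (f := fun _ => (lam ^ 2)⁻¹))
  have r2 := realizable_translation₃ (L := L) hT (contDiff_const.mul s2 (f := fun _ => (lam ^ 2)⁻¹))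
  have r3 := realizable_rotation (L := L) hT (contDiff_const.mul s3 (f := fun _ => (lam ^ 2)⁻¹))
    (contDiff_const (c := (1 : ℝ)))
  rw [dd s1 (deriv_deriv_smear hη i1)] at r1
  rw [dd s2 (deriv_deriv_smear hη i2)] at r2
  rw [dd s3 (deriv_deriv_smear hη i3)] at r3
  have s4 : ∀ i, ContDiff ℝ (⊤ : ℕ∞) fun x => ∫ y, η (lam * x + c - y) * α i y ∂volIoo 0 L :=
    fun i => contDiff_kernel_integral (hαi i) hu hη lam c
  have d4 : ∀ i, deriv (deriv fun x => ∫ y, η (lam * x + c - y) * α i y ∂volIoo 0 L) =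
      fun x => lam ^ 2 * ∫ y, deriv (deriv η) (lam * x + c - y) * α i y ∂volIoo 0 L := fun i =>
    deriv_deriv_of_hasDerivAt (fun x => hasDerivAt_kernel_integral (hαi i) hu hη lam c x)
      (fun x => hasDerivAt_kernel_integral (hαi i) hu hη.deriv lam c x)
  have r4 := realizable_sum (L := L) hT Finset.univ fun i => realizable_rotation (L := L) hT
    (contDiff_const.mul (s4 i) (f := fun _ => (lam ^ 2)⁻¹)) (contDiff_infty_prim (hβ i))
  simp only [fun i => dd (s4 i) (d4 i)] at r4
  have r := r0.add (r1.add (r2.add (r3.add r4)))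
  convert r using 1
  · ext p
    simp only [constantStrain, Finset.sum_neg_distrib]
    ring
  · ext p
    have hd : ∀ i, deriv (prim (β i)) p.2 = β i p.2 := fun i =>
      (hasDerivAt_prim (hβ i).continuous p.2).deriv
    simp only [hd, deriv_const, mul_zero, zero_add, mul_assoc, ← Finset.mul_sum]
    congr 1
    simp only [average, lineInt, Finset.mul_sum, ← integral_mul_const]
    rw [integral_finsetSum _ fun i _ => ?_]
    · simp only [mul_assoc]
    · simpa only [mul_assoc] using
        (integrable_kernel_mul (hαi i) hu hη (lam * p.1 + c)).mul_const (β i p.2)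

end Approximation

/-! ### Error estimates and choice of the parameters -/

theorem exists_eLpNorm_two_le_integral_abs_le (L : ℝ) {ε : ℝ} (hε : 0 < ε) :
    ∃ κ : ℝ≥0∞, κ ≠ 0 ∧ ∀ f : ℝ × ℝ → ℝ, AEStronglyMeasurable f (volOmega L) →
      eLpNorm f 2 (volOmega L) ≤ κ → ∫ p, |f p| ∂volOmega L ≤ ε := by
  set V := (volOmega L univ) ^ (1 / 2 : ℝ)
  have hV : V ≠ ⊤ := ENNReal.rpow_ne_top_of_nonneg (by norm_num) (measure_ne_top _ _)
  refine ⟨ENNReal.ofReal ε / (V + 1), by simp [ENNReal.div_eq_zero_iff, hε, hV], fun f hf h => ?_⟩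
  have h1 := eLpNorm_le_eLpNorm_mul_rpow_measure_univ (p := 1) (q := 2) (by norm_num) hf
  have h2 : eLpNorm f 1 (volOmega L) ≤ ENNReal.ofReal ε := by
    refine h1.trans ?_
    have e : (1 / (1 : ℝ≥0∞).toReal - 1 / (2 : ℝ≥0∞).toReal) = (1 / 2 : ℝ) := by norm_num
    rw [e]
    calc _ ≤ ENNReal.ofReal ε / (V + 1) * (V + 1) := by
          gcongr
          exact le_self_add
      _ = ENNReal.ofReal ε := ENNReal.div_mul_cancel (by simp) (by simp [hV])
  have h3 := integral_norm_eq_lintegral_enorm hf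
  simp only [Real.norm_eq_abs] at h3
  rw [h3, ← eLpNorm_one_eq_lintegral_enorm]
  exact ENNReal.toReal_le_of_le_ofReal hε.le h2

section Approximation

variable {L : ℝ} {γ : ℝ → E3} {T₂ T₃ : ℝ → ℝ} {θ v₂ v₃ b g : ℝ × ℝ → ℝ}

/-- Averages converge in `L²` also after multiplication by a factor that tends to `1`. -/
theorem eLpNorm_scaled_average_sub_le {δ lam c : ℝ} {η : ℝ → ℝ} (hη : IsMollifier L δ lam c η)
    (bm : Measurable b) (b2 : MemLp b 2 (volOmega L)) {C : ℝ × ℝ → ℝ} (hC : Continuous C)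
    {κ : ℝ≥0∞} (h1 : eLpNorm (fun p => average L lam c η b p - b p) 2 (volOmega L) ≤ κ)
    (h2 : ENNReal.ofReal (2 * δ) * eLpNorm b 2 (volOmega L) ≤ κ)
    (h3 : eLpNorm (fun p => b p - C p) 2 (volOmega L) ≤ κ) :
    eLpNorm (fun p => (lam ^ 2)⁻¹ * average L lam c η C p - b p) 2 (volOmega L) ≤ 16 * κ := by
  have hl := hη.half_le
  have hl0 : lam ^ 2 ≠ 0 := by positivity
  have hηc := hη.isTestOn.contDiff.continuous
  -- The error is lam⁻² [(avg b - b) + (1 - lam²) b - avg(b - C)]. Since lam⁻² ≤ 4 and 1 - lam² ≤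
  -- 2δ, the total is 4(κ + κ + 2κ).
  have e : (fun p => (lam ^ 2)⁻¹ * average L lam c η C p - b p) =ᵐ[volOmega L]
      (lam ^ 2)⁻¹ • (((fun p => average L lam c η b p - b p) + (1 - lam ^ 2) • b) -
        average L lam c η fun p => b p - C p) := by
    filter_upwards [average_sub_ae (lam := lam) (c := c) hη.isTestOn (b2.integrable (by norm_num))
      (integrable_volOmega_of_continuous (L := L) hC)] with p hp
    simp only [Pi.smul_apply, Pi.sub_apply, Pi.add_apply, hp, smul_eq_mul]
    field_simp
    ring
  have m1 : AEStronglyMeasurable (fun p => average L lam c η b p - b p) (volOmega L) :=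
    ((stronglyMeasurable_average hηc bm).sub bm.stronglyMeasurable).aestronglyMeasurable
  have m2 : AEStronglyMeasurable ((1 - lam ^ 2) • b) (volOmega L) := b2.1.const_smul _
  have m3 : AEStronglyMeasurable (average L lam c η fun p => b p - C p) (volOmega L) :=
    (stronglyMeasurable_average hηc (bm.sub hC.measurable)).aestronglyMeasurable
  have n1 : ‖(lam ^ 2)⁻¹‖ₑ ≤ 4 := by
    rw [Real.enorm_eq_ofReal (by positivity)]
    refine ENNReal.ofReal_le_of_le_toReal ?_
    rw [ENNReal.toReal_ofNat]
    exact inv_le_of_inv_le₀ (by norm_num) (by nlinarith)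
  have n2 : eLpNorm ((1 - lam ^ 2) • b) 2 (volOmega L) ≤ κ := by
    rw [eLpNorm_const_smul]
    refine le_trans ?_ h2
    gcongr
    have := hη.le_one
    have := hη.one_sub_le
    rw [Real.enorm_eq_ofReal (by nlinarith)]
    exact ENNReal.ofReal_le_ofReal (by nlinarith)
  have n3 := hη.eLpNorm_average_le (F := fun p => b p - C p) (bm.sub hC.measurable)
  rw [eLpNorm_congr_ae e, eLpNorm_const_smul]
  calc _ ≤ 4 * ((κ + κ) + 2 * κ) := by
        refine mul_le_mul' n1 ((eLpNorm_sub_le (m1.add m2) m3 (by norm_num)).trans ?_)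
        exact add_le_add ((eLpNorm_add_le m1 m2 (by norm_num)).trans (add_le_add h1 n2))
          (n3.trans (by gcongr))
    _ = 16 * κ := by ring

/-- The order of the choices matters: δ makes the averages close to g and b, then the mollifier
fixes the bound M on η'', and only then is b approximated by products, with an accuracy depending on
M. -/
theorem IsWeakSolution.exists_realizable_near (h : IsWeakSolution L T₂ T₃ θ v₂ v₃ b g)
    (hL : 0 < L) (hT : IsTangent γ T₂ T₃) (bm : Measurable b) (gm : Measurable g)
    (b2 : MemLp b 2 (volOmega L)) (g2 : MemLp g 2 (volOmega L)) {κ : ℝ} (hκ : 0 < κ) :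
    ∃ G B, Realizable L γ G B ∧
      eLpNorm (fun p => G p - g p) 2 (volOmega L) ≤ ENNReal.ofReal κ ∧
      eLpNorm (fun p => B p - b p) 2 (volOmega L) ≤ ENNReal.ofReal κ := by
  set K := ENNReal.ofReal κ with hK
  have hK0 : K ≠ 0 := by simp [hK, hκ]
  have hK1 : K ≠ ⊤ := ENNReal.ofReal_ne_top
  have hK2 : K / 2 ≠ 0 := by simp [ENNReal.div_eq_zero_iff, hK0]
  have hK16 : K / 16 ≠ 0 := by simp [ENNReal.div_eq_zero_iff, hK0]
  have hN := b2.eLpNorm_ne_top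
  set N := eLpNorm b 2 (volOmega L)
  obtain ⟨δ₁, hδ₁, H₁⟩ := exists_eLpNorm_average_sub_le gm g2 hK2
  obtain ⟨δ₂, hδ₂, H₂⟩ := exists_eLpNorm_average_sub_le bm b2 hK16
  have hr0 : K / 16 / (N + 1) ≠ 0 := by
    rw [Ne, ENNReal.div_eq_zero_iff, not_or]
    exact ⟨hK16, by simp [hN]⟩
  have hr1 : K / 16 / (N + 1) ≠ ⊤ :=
    ENNReal.div_ne_top (ENNReal.div_ne_top hK1 (by norm_num)) (by simp)
  set r := (K / 16 / (N + 1)).toReal with hr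
  have hrpos : 0 < r := ENNReal.toReal_pos hr0 hr1
  set δ := min δ₁ (min δ₂ (r / 2)) with hδdef
  have hδ : 0 < δ := by positivity
  have hδr : ENNReal.ofReal (2 * δ) * N ≤ K / 16 := by
    have h1 : 2 * δ ≤ r := by
      have : δ ≤ r / 2 := (min_le_right _ _).trans (min_le_right _ _)
      linarith
    calc ENNReal.ofReal (2 * δ) * N ≤ K / 16 / (N + 1) * (N + 1) := by
          gcongr
          · exact (ENNReal.ofReal_le_ofReal h1).trans_eq (ENNReal.ofReal_toReal hr1)
          · exact le_self_add
      _ = K / 16 := ENNReal.div_mul_cancel (by simp) (by simp [hN])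
  obtain ⟨lam, c, η, hη⟩ := exists_isMollifier hL hδ
  have hG1 := H₁ δ lam c η (min_le_left _ _) hη
  have hB1 := H₂ δ lam c η ((min_le_right _ _).trans (min_le_left _ _)) hη
  obtain ⟨M, hM0, hM⟩ := hη.isTestOn.deriv.deriv.exists_bound
  obtain ⟨D, hD, HD⟩ := exists_bound_eLpNorm_le L hK2
  -- With ‖b - C‖₁ ≤ D/(2(M + 1)) the strain error 2M‖b - C‖₁ is at most D; M + 1 avoids division by
  -- zero.
  obtain ⟨κ₁, hκ₁, Hκ₁⟩ := exists_eLpNorm_two_le_integral_abs_le L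
    (ε := D / (2 * (M + 1))) (by positivity)
  obtain ⟨n, α, β, hα, hβ, hC⟩ := exists_sum_mul_eLpNorm_sub_le b2
    (κ := min (K / 16) κ₁) (by simp [min_eq_iff, hK16, hκ₁])
  set C : ℝ × ℝ → ℝ := fun p => ∑ i, α i p.1 * β i p.2 with hCdef
  have hβc : ∀ i, Continuous (β i) := fun i => (hβ i).continuous
  have hCc : Continuous C := by fun_prop
  have hηc := hη.isTestOn.contDiff.continuous
  refine ⟨_, _, h.realizable (lam := lam) (c := c) hT hη.isTestOn (by linarith [hη.half_le]) hα hβ,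
    ?_, ?_⟩
  · set G : ℝ × ℝ → ℝ := fun p => constantStrain L lam c η T₂ T₃ θ v₂ v₃ b g p -
        ∑ i, (∫ y, deriv (deriv η) (lam * p.1 + c - y) * α i y ∂volIoo 0 L) *
          warping T₂ T₃ (prim (β i)) p.2
    have hGc : Continuous G := by
      refine (continuous_constantStrain h hT.continuous₂ hT.continuous₃ hη.isTestOn).sub
        (continuous_finsetSum _ fun i _ => ?_)
      have hαi : Integrable (α i) (volIoo 0 L) :=
        ((hα i).continuousOn.integrableOn_Icc (a := 0) (b := L)).mono_set Ioo_subset_Icc_self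
      exact ((contDiff_kernel_integral (u := fun y => y) hαi measurable_id.aestronglyMeasurable
        hη.isTestOn.deriv.deriv lam c).continuous.comp continuous_fst).mul
        ((continuous_warping hT.continuous₂ hT.continuous₃ (continuous_prim (hβc i))).comp
          continuous_snd)
    have hav := stronglyMeasurable_average (L := L) (lam := lam) (c := c) hηc gm
    have hdiff : ∀ᵐ p ∂volOmega L, |G p - average L lam c η g p| ≤ D := by
      -- The bound is known for each x and almost every s. Measurability of the set, which uses the
      -- measurable representative of g, upgrades it to almost every point of ω.
      have hms : MeasurableSet {p | |G p - average L lam c η g p| ≤ D} :=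
        measurableSet_le (hGc.measurable.sub hav.measurable).abs measurable_const
      rw [volOmega_eq_prod]
      refine (Measure.ae_prod_iff_ae_ae hms).2 ?_
      filter_upwards [ae_restrict_mem measurableSet_Ioo] with x hx
      filter_upwards [h.average_sub_le hT.continuous₂ hT.continuous₃ hT.sq_add_sq hη hM hα hβc
        (Ioo_subset_Icc_self hx)] with s hs
      refine hs.trans ?_
      have h1 := Hκ₁ (fun p => b p - C p) (b2.1.sub hCc.aestronglyMeasurable)
        (hC.trans (min_le_right _ _))
      have h2 : ∫ p, |b p - C p| ∂volOmega L ≤ D / (2 * (M + 1)) := h1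
      have h3 : 0 ≤ ∫ p, |b p - C p| ∂volOmega L := integral_nonneg fun _ => abs_nonneg _
      rw [le_div_iff₀ (by positivity)] at h2
      change 2 * (M * ∫ p, |b p - C p| ∂volOmega L) ≤ D
      nlinarith
    have e : (fun p => G p - g p) = (fun p => G p - average L lam c η g p) +
        fun p => average L lam c η g p - g p := by
      ext p; simp
    rw [e]
    refine (eLpNorm_add_le (hGc.aestronglyMeasurable.sub hav.aestronglyMeasurable)
      (hav.sub gm.stronglyMeasurable).aestronglyMeasurable (by norm_num)).trans ?_
    exact (add_le_add (HD _ hdiff) hG1).trans_eq (ENNReal.add_halves K)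
  · refine (eLpNorm_scaled_average_sub_le hη bm b2 hCc hB1 hδr
      (hC.trans (min_le_left _ _))).trans_eq ?_
    exact ENNReal.mul_div_cancel (by norm_num) (by norm_num)

end Approximation

/-! ### From the class C_μ to the weak equations -/

/-- The test function `ψ(x₁) ζ(s)` on `ω`. -/
def productTest {L : ℝ} {ψ ζ : ℝ → ℝ} (hψ : IsTestOn (Ioo 0 L) ψ) (hζ : IsTestOn (Ioo 0 1) ζ) :
    𝓓(omega L, ℝ) :=
  have hsub : tsupport (fun p : ℝ × ℝ => ψ p.1 * ζ p.2) ⊆ tsupport ψ ×ˢ tsupport ζ :=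
    closure_minimal (fun _ hp => ⟨subset_tsupport _ (left_ne_zero_of_mul hp),
      subset_tsupport _ (right_ne_zero_of_mul hp)⟩)
      ((isClosed_tsupport _).prod (isClosed_tsupport _))
  { toFun := fun p => ψ p.1 * ζ p.2
    contDiff' := (hψ.contDiff.comp contDiff_fst).mul (hζ.contDiff.comp contDiff_snd)
    hasCompactSupport' := (hψ.hasCompactSupport.prod hζ.hasCompactSupport).of_isClosed_subset
      (isClosed_tsupport _) hsub
    tsupport_subset' := hsub.trans (prod_mono hψ.tsupport_subset hζ.tsupport_subset) }

section ProductTest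

variable {L : ℝ} {ψ ζ : ℝ → ℝ} (hψ : IsTestOn (Ioo 0 L) ψ) (hζ : IsTestOn (Ioo 0 1) ζ)

theorem productTest_apply (p : ℝ × ℝ) : productTest hψ hζ p = ψ p.1 * ζ p.2 := rfl

theorem pdS_productTest (p : ℝ × ℝ) :
    pdS (productTest hψ hζ : ℝ × ℝ → ℝ) p = ψ p.1 * deriv ζ p.2 :=
  ((hζ.hasDerivAt p.2).const_mul (ψ p.1)).deriv

theorem pd1_pd1_productTest (p : ℝ × ℝ) :
    pd1 (pd1 (productTest hψ hζ : ℝ × ℝ → ℝ)) p = deriv (deriv ψ) p.1 * ζ p.2 := by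
  have e : pd1 (productTest hψ hζ : ℝ × ℝ → ℝ) = fun p => deriv ψ p.1 * ζ p.2 :=
    funext fun p => ((hψ.hasDerivAt p.1).mul_const (ζ p.2)).deriv
  rw [e]
  exact ((hψ.deriv.hasDerivAt p.1).mul_const (ζ p.2)).deriv

end ProductTest

theorem memLp_component {L : ℝ} {v : ℝ × ℝ → E3} (hv : MemLp v 2 (volOmega L)) (i : Fin 3) :
    MemLp (fun p => v p i) 2 (volOmega L) :=
  (EuclideanSpace.proj (𝕜 := ℝ) i : E3 →L[ℝ] ℝ).comp_memLp' hv

theorem integral_component {L : ℝ} {k : ℝ × ℝ → ℝ} {f : ℝ × ℝ → E3}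
    (h : Integrable (fun p => k p • f p) (volOmega L)) (i : Fin 3) :
    (∫ p, k p • f p ∂volOmega L) i = ∫ p, k p * f p i ∂volOmega L :=
  ((EuclideanSpace.proj (𝕜 := ℝ) i : E3 →L[ℝ] ℝ).integral_comp_comm h).symm

theorem integrable_smul_of_tests {L : ℝ} {U U' : Set ℝ} {ψ ζ : ℝ → ℝ} (hψ : IsTestOn U ψ)
    (hζ : IsTestOn U' ζ) {f : ℝ × ℝ → E3} (hf : Integrable f (volOmega L)) :
    Integrable (fun p => (ψ p.1 * ζ p.2) • f p) (volOmega L) := by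
  obtain ⟨C, hC0, hC⟩ := hψ.exists_bound
  obtain ⟨D, -, hD⟩ := hζ.exists_bound
  refine hf.bdd_smul (C * D) ((hψ.contDiff.continuous.comp continuous_fst).mul
    (hζ.contDiff.continuous.comp continuous_snd)).aestronglyMeasurable
    (Eventually.of_forall fun p => ?_)
  rw [Pi.mul_apply, norm_mul]
  exact mul_le_mul (hC _) (hD _) (abs_nonneg _) hC0

theorem IsWeakPdS.component {L : ℝ} {v w : ℝ × ℝ → E3} (h : IsWeakPdS L v w)
    (hv : Integrable v (volOmega L)) (hw : Integrable w (volOmega L)) (i : Fin 3) {ψ ζ : ℝ → ℝ}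
    (hψ : IsTestOn (Ioo 0 L) ψ) (hζ : IsTestOn (Ioo 0 1) ζ) :
    ∫ p, deriv ζ p.2 * (ψ p.1 * v p i) ∂volOmega L =
      -∫ p, ζ p.2 * (ψ p.1 * w p i) ∂volOmega L := by
  have h1 := congrArg (fun u : E3 => u i) (h (productTest hψ hζ))
  simp only [pdS_productTest, productTest_apply, PiLp.neg_apply] at h1
  rw [integral_component (integrable_smul_of_tests hψ hζ.deriv hv),
    integral_component (integrable_smul_of_tests hψ hζ hw)] at h1
  simp only [mul_assoc, mul_left_comm (ψ _)] at h1
  exact h1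

/-- Product test functions suffice. As w · τ = 0 and (τ, n) is orthonormal in the plane of the
curve, (w₂, w₃) = θ n with θ = w · n. The component v₁ never enters because τ₁ = 0. The factor μ is
absorbed into the strain g'. -/
theorem exists_isWeakSolution {L μ : ℝ} {γ : ℝ → E3} {T₂ T₃ : ℝ → ℝ} (hT : IsTangent γ T₂ T₃)
    {g b g' b' : ℝ × ℝ → ℝ} (hgb : (g, b) ∈ classC L μ γ)
    (hg' : (fun p => μ * g p) =ᵐ[volOmega L] g') (hb' : b =ᵐ[volOmega L] b') :
    ∃ θ v₂ v₃, IsWeakSolution L T₂ T₃ θ v₂ v₃ b' g' := by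
  obtain ⟨hg, hb, v, w, hv, hw, hvw, hwτ, hwn, hstrain⟩ := hgb
  simp only at hg hb hwn hstrain
  have hvi : Integrable v (volOmega L) := hv.integrable (by norm_num)
  have hwi : Integrable w (volOmega L) := hw.integrable (by norm_num)
  have hvc := fun i => (memLp_component hv i).integrable (q := 2) (by norm_num)
  have hwc := fun i => (memLp_component hw i).integrable (q := 2) (by norm_num)
  set θ : ℝ × ℝ → ℝ := fun p => w p 1 * -T₃ p.2 + w p 2 * T₂ p.2 with hθ
  have eθ : ∀ᵐ p ∂volOmega L, ⟪w p, normalVec γ p.2⟫ = θ p := by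
    filter_upwards [ae_mem_omega L] with p hp
    rw [hT.normalVec_eq (Ioo_subset_Icc_self hp.2), inner_vec3]
    simp only [hθ]; ring
  have hw0 : ∀ᵐ p ∂volOmega L, w p 1 = -T₃ p.2 * θ p ∧ w p 2 = T₂ p.2 * θ p := by
    filter_upwards [ae_mem_omega L, hwτ] with p hp h1
    have hs := Ioo_subset_Icc_self hp.2
    rw [hT.tangentVec_eq _ hs, inner_vec3] at h1
    have := hT.sq_add_sq _ hs
    simp only [hθ]
    constructor
    · linear_combination (-(w p 1)) * this + T₂ p.2 * h1
    · linear_combination (-(w p 2)) * this + T₃ p.2 * h1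
  refine ⟨θ, fun p => v p 1, fun p => v p 2, ?_, hvc 1, hvc 2,
    (hb.integrable (by norm_num)).congr hb', ((hg.integrable (by norm_num)).const_mul μ).congr hg',
    fun ψ ζ hψ hζ => ?_, fun ψ ζ hψ hζ => ?_, fun ψ ζ hψ hζ => ?_, fun ψ ζ hψ hζ => ?_⟩
  · have a := integrable_mul_snd (u := fun s => -T₃ s) (hwc 1) hT.continuous₃.neg
    have b := integrable_mul_snd (hwc 2) hT.continuous₂
    refine (a.add b).congr (Eventually.of_forall fun p => ?_)
    simp only [hθ, Pi.add_apply]; ring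
  · have h1 := hwn (productTest hψ hζ)
    simp only [pdS_productTest, productTest_apply, smul_eq_mul] at h1
    have e1 : ∫ p, deriv ζ p.2 * (ψ p.1 * θ p) ∂volOmega L =
        ∫ p, ψ p.1 * deriv ζ p.2 * ⟪w p, normalVec γ p.2⟫ ∂volOmega L :=
      integral_congr_ae (by filter_upwards [eθ] with p hp; rw [hp]; ring)
    have e2 : ∫ p, ζ p.2 * (ψ p.1 * b' p) ∂volOmega L = ∫ p, ψ p.1 * ζ p.2 * b p ∂volOmega L :=
      integral_congr_ae (by filter_upwards [hb'] with p hp; rw [hp]; ring)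
    rw [e1, e2, h1]
  · rw [hvw.component hvi hwi 1 hψ hζ]
    exact congrArg _ (integral_congr_ae (by filter_upwards [hw0] with p hp; rw [hp.1]))
  · rw [hvw.component hvi hwi 2 hψ hζ]
    exact congrArg _ (integral_congr_ae (by filter_upwards [hw0] with p hp; rw [hp.2]))
  · have h1 := hstrain (productTest hψ hζ)
    simp only [pdS_productTest, pd1_pd1_productTest] at h1
    have e1 : ∫ p, deriv ζ p.2 * (ψ p.1 * g' p) ∂volOmega L =
        μ * ∫ p, g p * (ψ p.1 * deriv ζ p.2) ∂volOmega L := by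
      rw [← integral_const_mul]
      exact integral_congr_ae (by filter_upwards [hg'] with p hp; rw [← hp]; ring)
    have e2 : ∫ p, ζ p.2 * (-(deriv (deriv ψ) p.1 * (T₂ p.2 * v p 1 + T₃ p.2 * v p 2))) ∂volOmega L
        = -∫ p, ⟪v p, tangentVec γ p.2⟫ * (deriv (deriv ψ) p.1 * ζ p.2) ∂volOmega L := by
      rw [← integral_neg]
      refine integral_congr_ae ?_
      filter_upwards [ae_mem_omega L] with p hp
      rw [hT.tangentVec_eq _ (Ioo_subset_Icc_self hp.2), inner_vec3]
      ring
    rw [e1, e2]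
    linarith

theorem norm_matrix_single (a : ℝ) : ‖(!![a, 0; 0, 0] : Matrix (Fin 2) (Fin 2) ℝ)‖ = ‖a‖ := by
  rw [Matrix.frobenius_norm_def]
  simp only [Fin.sum_univ_two, Matrix.of_apply, Matrix.cons_val', Matrix.cons_val_zero,
    Matrix.cons_val_one, Matrix.cons_val_fin_one, norm_zero, ← Real.sqrt_eq_rpow]
  simp [Real.sqrt_sq_eq_abs]

end ThinWalledBeam

/-! ### The approximating sequence -/

open ThinWalledBeam
theorem lemma4 (L : ℝ) (hL : 0 < L) (γ : ℝ → E3) (hγ : IsPlanarArclengthCurve γ)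
    (μ : ℝ) (hμ : μ ≠ 0) (g b : ℝ × ℝ → ℝ) (hgb : (g, b) ∈ classC L μ γ) :
    ∃ φ : ℕ → ℝ × ℝ → E3,
      (∀ j, ContDiffOn ℝ 5 (φ j) (Icc 0 L ×ˢ Icc 0 1)) ∧
      (∀ j, ∀ p ∈ omega L, symGrad γ (φ j) p = !![pd1 (fun q => φ j q 0) p, 0; 0, 0]) ∧
      TendstoL2 L (fun j => symGrad γ (φ j)) (fun p => !![μ * g p, 0; 0, 0]) ∧
      TendstoL2 L (fun j => bending γ (φ j)) b := by
  obtain ⟨T₂, T₃, hT⟩ := hγ.exists_isTangent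
  have hg2 : MemLp (fun p => μ * g p) 2 (volOmega L) := hgb.1.const_mul μ
  have hb2 : MemLp b 2 (volOmega L) := hgb.2.1
  -- Measurable representatives of μg and b; the averaging estimates need genuine measurability on
  -- lines.
  obtain ⟨g', gm, hg'⟩ := hg2.1
  obtain ⟨b', bm, hb'⟩ := hb2.1
  obtain ⟨θ, v₂, v₃, hsol⟩ := exists_isWeakSolution hT hgb hg' hb'
  have key : ∀ j : ℕ, ∃ G B, Realizable L γ G B ∧
      eLpNorm (fun p => G p - g' p) 2 (volOmega L) ≤ ENNReal.ofReal (1 / ((j : ℝ) + 1)) ∧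
      eLpNorm (fun p => B p - b' p) 2 (volOmega L) ≤ ENNReal.ofReal (1 / ((j : ℝ) + 1)) :=
    fun j => hsol.exists_realizable_near hL hT bm.measurable gm.measurable
      ((memLp_congr_ae hb').1 hb2) ((memLp_congr_ae hg').1 hg2) (by positivity)
  choose G B hR hG hB using key
  choose φ hφ hφp using hR
  have hpd : ∀ j, ∀ p ∈ omega L, pd1 (fun q => φ j q 0) p = G j p := fun j p hp => by
    simpa [symGrad] using congrArg (fun A : Matrix (Fin 2) (Fin 2) ℝ => A 0 0) (hφp j p hp).1
  have hlim : Tendsto (fun j : ℕ => ENNReal.ofReal (1 / ((j : ℝ) + 1))) atTop (𝓝 0) := by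
    simpa using ENNReal.tendsto_ofReal tendsto_one_div_add_atTop_nhds_zero_nat
  refine ⟨φ, hφ, fun j p hp => ?_, ?_, ?_⟩
  · rw [(hφp j p hp).1, hpd j p hp]
  · refine tendsto_of_tendsto_of_tendsto_of_le_of_le tendsto_const_nhds hlim
      (fun _ => zero_le) fun j => le_trans (le_of_eq ?_) (hG j)
    refine eLpNorm_congr_norm_ae ?_
    filter_upwards [ae_mem_omega L, hg'] with p hp h1
    rw [(hφp j p hp).1, h1, ← norm_matrix_single]
    congr 1
    ext i k
    fin_cases i <;> fin_cases k <;> simp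
  · refine tendsto_of_tendsto_of_tendsto_of_le_of_le tendsto_const_nhds hlim
      (fun _ => zero_le) fun j => le_trans (le_of_eq ?_) (hB j)
    refine eLpNorm_congr_ae ?_
    filter_upwards [ae_mem_omega L, hb'] with p hp h1
    rw [h1]
    exact congrArg (· - b' p) (hφp j p hp).2.deriv
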